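/- Let $n\ge 0$, let $D>0$ (input delay) and $\tau_d>0$ (dwell time) be arbitrary, let $P=P^{T}>0$ and $Q=Q^{T}>0$ be real $n\times n$ matrices, and let $M_A,M_B,M_K$ be real numbers. Let $|\cdot|$ denote the Euclidean norm of vectors and the induced norm of matrices. There is $\epsilon^*>0$, depending only on $n,D,\tau_d,P,Q,M_A,M_B,M_K$, such that the following holds. Let $l\ge 0$ and, for $i=0,\dots,l$, let $A_i\in\mathbb R^{n\times n}$, $B_i\in\mathbb R^{n\times 1}$, $K_i\in\mathbb R^{1\times n}$ satisfy $|A_i|\le M_A$, $|B_i|\le M_B$, $|K_i|\le M_K$, $$(A_i+B_iK_i)^{T}P+P(A_i+B_iK_i)\le -Q ,$$ and $$\epsilon:=\max_{i,j=0,\dots,l}\{|A_i-A_j|,\,|B_i-B_j|,\,|K_i-K_j|\}<\epsilon^* .$$ Then there are constants $\rho,\xi>0$ such that for every right-continuous piecewise constant switching signal $\sigma:[0,\infty)\to\{0,\dots,l\}$ whose distinct switching times are at least $\tau_d$ apart, for all $X_0\in\mathbb R^n$ and $U_0\in L^2[-D,0]$, every solution $(X,U)$ of the closed-loop system $$\dot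 X(t)=A_{\sigma(t)}X(t)+B_{\sigma(t)}U(t-D),\qquad U(t)=\frac1{l+1}\sum_{i=0}^{l}K_i\hat P_i(t),\qquad t\ge 0,$$ $$\hat P_i(t)=e^{A_iD}X(t)+\int_{t-D}^{t}e^{A_i(t-\theta)}B_iU(\theta)\,d\theta ,$$ with $X(0)=X_0$ and $U=U_0$ almost everywhere on $[-D,0)$, satisfies $$|X(t)|+\sqrt{\int_{t-D}^{t}U(\theta)^2\,d\theta}\;\le\;\rho\left(|X_0|+\sqrt{\int_{-D}^{0}U_0(\theta)^2\,d\theta}\right)e^{-\xi t},\qquad t\ge 0 .$$ Here a solution is a pair with $X$ continuous on $[0,\infty)$, $U$ square integrable on $[-D,T]$ for every $T\ge0$, the differential equation holding in the integrated (Carathéodory) sense, and the formula for $U(t)$ holding for every $t\ge0$. -/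

import Mathlib

open Filter Topology MeasureTheory
open scoped Matrix Matrix.Norms.L2Operator

namespace SwitchedDelay

noncomputable section

/-- `t > 0` is a switching time of `σ` if `σ` jumps at `t`, that is, if `σ` is not constantly
equal to `σ t` on any interval `(t - δ, t]`. -/
def IsSwitchingTime {l : ℕ} (σ : ℝ → Fin (l + 1)) (t : ℝ) : Prop :=
  0 < t ∧ ¬ ∀ᶠ s in 𝓝[<] t, σ s = σ t

/-- Right-continuous piecewise constant switching signals on `[0, ∞)` with values in
`{0, …, l}` and dwell time `τ`: two distinct switching times are at least `τ` apart.
(For `τ > 0` the switching times are therefore locally finite, and `σ` is constant between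
consecutive ones.) The values of `σ` at negative times play no role. -/
structure IsSwitchingSignal {l : ℕ} (τ : ℝ) (σ : ℝ → Fin (l + 1)) : Prop where
  right_continuous : ∀ t, 0 ≤ t → ∀ᶠ s in 𝓝[>] t, σ s = σ t
  dwell : ∀ s t, IsSwitchingTime σ s → IsSwitchingTime σ t → s < t → τ ≤ t - s

/-- The exact predictor of the single mode `(A, B)` with input delay `D`:
`e^{A D} X(t) + ∫_{t-D}^t e^{A (t-θ)} B U(θ) dθ`. -/
def predictor {n : ℕ} (D : ℝ) (A : Matrix (Fin n) (Fin n) ℝ) (B : Matrix (Fin n) (Fin 1) ℝ)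
    (X : ℝ → Fin n → ℝ) (U : ℝ → ℝ) (t : ℝ) : Fin n → ℝ :=
  NormedSpace.exp (D • A) *ᵥ X t
    + ∫ θ in (t - D)..t, NormedSpace.exp ((t - θ) • A) *ᵥ (B *ᵥ ![U θ])

/-- The average `(1/(l+1)) ∑ i, K_i P̂_i(t)` of the predictor-feedback laws of the modes. -/
def averagedFeedback {n l : ℕ} (D : ℝ) (A : Fin (l + 1) → Matrix (Fin n) (Fin n) ℝ)
    (B : Fin (l + 1) → Matrix (Fin n) (Fin 1) ℝ) (K : Fin (l + 1) → Matrix (Fin 1) (Fin n) ℝ)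
    (X : ℝ → Fin n → ℝ) (U : ℝ → ℝ) (t : ℝ) : ℝ :=
  ∑ i, (K i *ᵥ predictor D (A i) (B i) X U t) 0 / ((l : ℝ) + 1)

/-- `(X, U)` is a (Carathéodory) solution of the closed loop
`X'(t) = A_{σ(t)} X(t) + B_{σ(t)} U(t - D)`, `U(t) = (1/(l+1)) ∑ i, K_i P̂_i(t)`, `t ≥ 0`, with
initial state `X₀` and initial input history `U₀` on `[-D, 0)`. The input is locally square
integrable and the state is continuous. As `U₀` is only an `L²` function, the differential
equation holds in integrated form, i.e. `X` is locally absolutely continuous and the equation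
holds for almost every `t`. Only `X` on `[0, ∞)` and `U` on `[-D, ∞)` matter. -/
structure IsClosedLoopSolution {n l : ℕ} (D : ℝ) (A : Fin (l + 1) → Matrix (Fin n) (Fin n) ℝ)
    (B : Fin (l + 1) → Matrix (Fin n) (Fin 1) ℝ) (K : Fin (l + 1) → Matrix (Fin 1) (Fin n) ℝ)
    (σ : ℝ → Fin (l + 1)) (X₀ : Fin n → ℝ) (U₀ : ℝ → ℝ)
    (X : ℝ → Fin n → ℝ) (U : ℝ → ℝ) : Prop where
  state_continuous : ContinuousOn X (Set.Ici 0)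
  input_memLp : ∀ T, 0 ≤ T → MemLp U 2 (volume.restrict (Set.Icc (-D) T))
  initial_state : X 0 = X₀
  initial_input : ∀ᵐ θ ∂volume.restrict (Set.Ico (-D) 0), U θ = U₀ θ
  dynamics : ∀ t, 0 ≤ t →
    X t = X 0 + ∫ s in (0 : ℝ)..t, (A (σ s) *ᵥ X s + B (σ s) *ᵥ ![U (s - D)])
  feedback : ∀ t, 0 ≤ t → U t = averagedFeedback D A B K X U t

/-- The mismatch `ε = max_{i,j} {|A_i - A_j|, |B_i - B_j|, |K_i - K_j|}`, where `|·|` is the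
matrix norm induced by the Euclidean norms. -/
def mismatch {n l : ℕ} (A : Fin (l + 1) → Matrix (Fin n) (Fin n) ℝ)
    (B : Fin (l + 1) → Matrix (Fin n) (Fin 1) ℝ)
    (K : Fin (l + 1) → Matrix (Fin 1) (Fin n) ℝ) : ℝ :=
  ⨆ p : Fin (l + 1) × Fin (l + 1),
    max ‖A p.1 - A p.2‖ (max ‖B p.1 - B p.2‖ ‖K p.1 - K p.2‖)

/-- The Euclidean norm of the state plus the `L²` norm of the input over `[t - D, t]`. -/
def stateNorm {n : ℕ} (D : ℝ) (X : ℝ → Fin n → ℝ) (U : ℝ → ℝ) (t : ℝ) : ℝ :=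
  ‖WithLp.toLp 2 (X t)‖ + √(∫ θ in (t - D)..t, U θ ^ 2)

end

end SwitchedDelay

/-! Mode 0 is taken as the nominal mode and all else is a perturbation of it. With `p` the exact
predictor of mode 0, the loop reads `X' = A₀ X + U(t-D) B₀ + d`, `U = K₀ p + w`. Switching enters
only `d`, of size `ε (|X| + |U(t-D)|)`. Averaging enters only `w`, of size `C ε (|X| + u)` with `u`
the `L²` norm of the input window, because a predictor depends Lipschitz continuously on its mode
(`exists_opPredictor_bounds`).

The predictor removes the delay: `p' = (A₀ + B₀ K₀) p + w B₀ + e^{A₀ D} d`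
(`HasIntegralDeriv.opPredictor`). Take `V = ⟪p, P p⟫ + a W`, where `W` is the input energy with
weight `e^{θ-t}`. Since `W' = -W + U(t)² - e^{-D} U(t-D)²`, the term `-W` damps the history, the
term in `U(t-D)²` absorbs the delayed input in `d`, and `a U(t)²` is dominated by the dissipation in
`p` when `a` is small. Hence `V' ≤ -ξ V` for small `ε` (`exists_lyapunov_constants`), whatever `σ`
does, because `V` does not involve `σ`; all that is needed of `σ` is measurability. As `e^{A₀ D}` is
invertible, `|p| + u` and `|X| + u` are equivalent, so the decay of `V` gives that of the state. All
constants depend on the modes only through their bounds.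

The input is merely `L²`, so differentiation is replaced throughout by the relation of being a
primitive of a locally integrable function. -/

namespace SwitchedDelay

/-! ### Calculus of primitives of locally integrable functions. -/

section IntegralDeriv

variable {E F G : Type*} [NormedAddCommGroup E] [NormedSpace ℝ E]
  [NormedAddCommGroup F] [NormedSpace ℝ F]
  [NormedAddCommGroup G] [NormedSpace ℝ G]

/-- `f` is, on `[0, ∞)`, a primitive of the locally integrable function `f'`. -/
structure HasIntegralDeriv (f f' : ℝ → E) : Prop where
  intervalIntegrable : ∀ t, 0 ≤ t → IntervalIntegrable f' volume 0 t
  eq_add_integral : ∀ t, 0 ≤ t → f t = f 0 + ∫ s in (0 : ℝ)..t, f' s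

namespace HasIntegralDeriv

theorem intervalIntegrable' {f f' : ℝ → E} (hf : HasIntegralDeriv f f') {s t : ℝ} (hs : 0 ≤ s)
    (ht : 0 ≤ t) : IntervalIntegrable f' volume s t :=
  (hf.intervalIntegrable s hs).symm.trans (hf.intervalIntegrable t ht)

theorem sub_eq_integral {f f' : ℝ → E} (hf : HasIntegralDeriv f f') {s t : ℝ} (hs : 0 ≤ s)
    (ht : 0 ≤ t) : f t - f s = ∫ r in s..t, f' r := by
  rw [hf.eq_add_integral t ht, hf.eq_add_integral s hs,
    ← intervalIntegral.integral_interval_sub_left (hf.intervalIntegrable t ht)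
      (hf.intervalIntegrable s hs)]
  abel

theorem continuousOn_Icc {f f' : ℝ → E} (hf : HasIntegralDeriv f f') {T : ℝ} (hT : 0 ≤ T) :
    ContinuousOn f (Set.Icc 0 T) := by
  have h : ContinuousOn (fun t => f 0 + ∫ s in (0 : ℝ)..t, f' s) (Set.Icc 0 T) := by
    have := intervalIntegral.continuousOn_primitive_interval'
      (hf.intervalIntegrable T hT) (Set.left_mem_uIcc)
    rw [Set.uIcc_of_le hT] at this
    exact continuousOn_const.add this
  exact h.congr fun t ht => hf.eq_add_integral t ht.1

theorem continuousOn {f f' : ℝ → E} (hf : HasIntegralDeriv f f') :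
    ContinuousOn f (Set.Ici 0) := by
  intro t ht
  have h := hf.continuousOn_Icc (T := t + 1) (by linarith [Set.mem_Ici.1 ht]) t
    ⟨ht, by linarith⟩
  refine h.mono_of_mem_nhdsWithin ?_
  have : Set.Iio (t + 1) ∈ 𝓝[Set.Ici 0] t := mem_nhdsWithin_of_mem_nhds (Iio_mem_nhds (by linarith))
  filter_upwards [this, self_mem_nhdsWithin] with x hx hx0 using ⟨hx0, le_of_lt hx⟩

theorem congr {f f' g g' : ℝ → E} (hf : HasIntegralDeriv f f') (h : ∀ t, 0 ≤ t → g t = f t)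
    (h' : ∀ t, 0 ≤ t → g' t = f' t) : HasIntegralDeriv g g' := by
  have key : ∀ t, 0 ≤ t → Set.EqOn f' g' (Set.uIoc 0 t) := by
    intro t ht s hs
    rw [Set.uIoc_of_le ht] at hs
    exact (h' s hs.1.le).symm
  refine ⟨fun t ht => (hf.intervalIntegrable t ht).congr (key t ht), fun t ht => ?_⟩
  rw [h t ht, h 0 le_rfl, hf.eq_add_integral t ht,
    intervalIntegral.integral_congr_ae (ae_of_all _ (key t ht))]

theorem add {f f' g g' : ℝ → E} (hf : HasIntegralDeriv f f') (hg : HasIntegralDeriv g g') :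
    HasIntegralDeriv (fun t => f t + g t) (fun t => f' t + g' t) := by
  refine ⟨fun t ht => (hf.intervalIntegrable t ht).add (hg.intervalIntegrable t ht),
    fun t ht => ?_⟩
  rw [intervalIntegral.integral_add (hf.intervalIntegrable t ht) (hg.intervalIntegrable t ht),
    hf.eq_add_integral t ht, hg.eq_add_integral t ht]
  abel

theorem clm_comp [CompleteSpace E] [CompleteSpace F] {f f' : ℝ → E} (hf : HasIntegralDeriv f f') (L : E →L[ℝ] F) :
    HasIntegralDeriv (fun t => L (f t)) (fun t => L (f' t)) := by
  refine ⟨fun t ht => ?_, fun t ht => ?_⟩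
  · have h := hf.intervalIntegrable t ht
    exact ⟨L.integrable_comp h.1, L.integrable_comp h.2⟩
  · rw [hf.eq_add_integral t ht, map_add,
      L.intervalIntegral_comp_comm (hf.intervalIntegrable t ht)]

theorem of_hasDerivAt [CompleteSpace E] {f f' : ℝ → E} (h : ∀ t, HasDerivAt f (f' t) t) (hc : Continuous f') :
    HasIntegralDeriv f f' := by
  refine ⟨fun t _ => hc.intervalIntegrable _ _, fun t _ => ?_⟩
  rw [intervalIntegral.integral_eq_sub_of_hasDerivAt (fun s _ => h s) (hc.intervalIntegrable _ _)]
  abel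

/-- The sliding window integral `t ↦ ∫_{t-D}^t h`. -/
theorem window {h : ℝ → E} {D : ℝ} (hD : 0 ≤ D)
    (hi : ∀ t, 0 ≤ t → IntervalIntegrable h volume (-D) t) :
    HasIntegralDeriv (fun t => ∫ s in (t - D)..t, h s) (fun t => h t - h (t - D)) := by
  have hi' : ∀ s t, -D ≤ s → -D ≤ t → IntervalIntegrable h volume s t := by
    have key : ∀ s, -D ≤ s → IntervalIntegrable h volume (-D) s := by
      intro s hs
      refine (hi (max s 0) (le_max_right _ _)).mono_set ?_
      rw [Set.uIcc_of_le hs, Set.uIcc_of_le (hs.trans (le_max_left _ _))]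
      exact Set.Icc_subset_Icc_right (le_max_left _ _)
    exact fun s t hs ht => (key s hs).symm.trans (key t ht)
  have hi₂ : ∀ t, 0 ≤ t → IntervalIntegrable (fun s => h (s - D)) volume 0 t := by
    intro t ht
    have := (hi' (-D) (t - D) le_rfl (by linarith)).comp_sub_right D
    simpa using this
  refine ⟨fun t ht => (hi' 0 t (by linarith) (by linarith)).sub (hi₂ t ht), fun t ht => ?_⟩
  rw [intervalIntegral.integral_sub (hi' 0 t (by linarith) (by linarith)) (hi₂ t ht),
    intervalIntegral.integral_comp_sub_right, zero_sub,
    ← intervalIntegral.integral_add_adjacent_intervals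
      (hi' (t - D) (-D) (by linarith) le_rfl) (hi' (-D) t le_rfl (by linarith)),
    ← intervalIntegral.integral_add_adjacent_intervals
      (hi' (-D) 0 le_rfl (by linarith)) (hi' 0 t (by linarith) (by linarith)),
    intervalIntegral.integral_symm (t - D) (-D)]
  abel

end HasIntegralDeriv

theorem intervalIntegrable_bilin (L : E →L[ℝ] F →L[ℝ] G) {f : ℝ → E} {g : ℝ → F} {a b : ℝ}
    (hab : a ≤ b) (hf : ContinuousOn f (Set.Icc a b)) (hg : IntervalIntegrable g volume a b) :
    IntervalIntegrable (fun s => L (f s) (g s)) volume a b := by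
  rw [intervalIntegrable_iff_integrableOn_Icc_of_le hab] at hg ⊢
  obtain ⟨C, hC⟩ := isCompact_Icc.exists_bound_of_continuousOn hf
  exact L.integrable_of_bilin_of_bdd_left C
    (hf.aestronglyMeasurable measurableSet_Icc)
    ((ae_restrict_iff' measurableSet_Icc).2 (ae_of_all _ hC)) hg

/-- Fubini's theorem on the triangle `0 < r ≤ s ≤ t` for a bilinear integrand. -/
theorem integral_bilin_triangle [CompleteSpace E] [CompleteSpace F] [CompleteSpace G]
     (L : E →L[ℝ] F →L[ℝ] G) {f : ℝ → E} {g : ℝ → F} {t : ℝ}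
    (ht : 0 ≤ t) (hf : IntervalIntegrable f volume 0 t) (hg : IntervalIntegrable g volume 0 t) :
    ∫ s in (0 : ℝ)..t, L (f s) (∫ r in (0 : ℝ)..s, g r)
      = ∫ r in (0 : ℝ)..t, L (∫ s in r..t, f s) (g r) := by
  have hf' : IntegrableOn f (Set.Ioc 0 t) := hf.1
  have hg' : IntegrableOn g (Set.Ioc 0 t) := hg.1
  have hprod : Integrable (fun z : ℝ × ℝ => L (f z.1) (g z.2))
      ((volume.restrict (Set.Ioc 0 t)).prod (volume.restrict (Set.Ioc 0 t))) :=
    hf'.op_fst_snd (op := fun x y => L x y) L.continuous₂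
      ⟨‖L‖₊, fun x y => by exact_mod_cast L.le_opNorm₂ x y⟩ hg'
  have hT : MeasurableSet {z : ℝ × ℝ | z.2 ≤ z.1} := measurableSet_le measurable_snd measurable_fst
  -- Both sides are iterated integrals over the square of the integrand cut off to the triangle.
  have hswap := integral_integral_swap (μ := volume.restrict (Set.Ioc 0 t))
    (ν := volume.restrict (Set.Ioc 0 t))
    (f := fun s r => Set.indicator {z : ℝ × ℝ | z.2 ≤ z.1} (fun z => L (f z.1) (g z.2)) (s, r))
    (by simpa [Function.uncurry_def] using hprod.indicator hT)
  rw [intervalIntegral.integral_of_le ht, intervalIntegral.integral_of_le ht]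
  convert hswap using 1
  · refine setIntegral_congr_fun measurableSet_Ioc fun s hs => ?_
    have hgs : IntervalIntegrable g volume 0 s := by
      refine hg.mono_set ?_
      rw [Set.uIcc_of_le hs.1.le, Set.uIcc_of_le ht]
      exact Set.Icc_subset_Icc_right hs.2
    rw [← ContinuousLinearMap.intervalIntegral_comp_comm _ hgs,
      intervalIntegral.integral_of_le hs.1.le]
    have : (fun r => Set.indicator {z : ℝ × ℝ | z.2 ≤ z.1} (fun z => L (f z.1) (g z.2)) (s, r))
        = Set.indicator (Set.Iic s) (fun r => L (f s) (g r)) := by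
      ext r
      simp [Set.indicator_apply]
    rw [this, integral_indicator measurableSet_Iic, Measure.restrict_restrict measurableSet_Iic,
      Set.Iic_inter_Ioc_of_le hs.2]
  · refine setIntegral_congr_fun measurableSet_Ioc fun r hr => ?_
    have hfr : IntervalIntegrable f volume r t := by
      refine hf.mono_set ?_
      rw [Set.uIcc_of_le hr.2, Set.uIcc_of_le ht]
      exact Set.Icc_subset_Icc_left hr.1.le
    rw [← L.flip_apply, ← ContinuousLinearMap.intervalIntegral_comp_comm _ hfr,
      intervalIntegral.integral_of_le hr.2, ← integral_Icc_eq_integral_Ioc]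
    have : (fun s => Set.indicator {z : ℝ × ℝ | z.2 ≤ z.1} (fun z => L (f z.1) (g z.2)) (s, r))
        = Set.indicator (Set.Ici r) (fun s => L (f s) (g r)) := by
      ext s
      simp [Set.indicator_apply]
    rw [this, integral_indicator measurableSet_Ici, Measure.restrict_restrict measurableSet_Ici]
    have : Set.Ici r ∩ Set.Ioc 0 t = Set.Icc r t := by
      ext x
      simp only [Set.mem_inter_iff, Set.mem_Ici, Set.mem_Ioc, Set.mem_Icc]
      exact ⟨fun h => ⟨h.1, h.2.2⟩, fun h => ⟨h.1, hr.1.trans_le h.1, h.2⟩⟩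
    rw [this]
    rfl

/-- Product rule. -/
theorem HasIntegralDeriv.bilin [CompleteSpace E] [CompleteSpace F] [CompleteSpace G]
     {f f' : ℝ → E} {g g' : ℝ → F} (hf : HasIntegralDeriv f f')
    (hg : HasIntegralDeriv g g') (L : E →L[ℝ] F →L[ℝ] G) :
    HasIntegralDeriv (fun t => L (f t) (g t)) (fun t => L (f' t) (g t) + L (f t) (g' t)) := by
  have i₁ : ∀ t, 0 ≤ t → IntervalIntegrable (fun s => L (f' s) (g s)) volume 0 t :=
    fun t ht => intervalIntegrable_bilin L.flip ht (hg.continuousOn_Icc ht)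
      (hf.intervalIntegrable t ht)
  have i₂ : ∀ t, 0 ≤ t → IntervalIntegrable (fun s => L (f s) (g' s)) volume 0 t :=
    fun t ht => intervalIntegrable_bilin L ht (hf.continuousOn_Icc ht)
      (hg.intervalIntegrable t ht)
  refine ⟨fun t ht => (i₁ t ht).add (i₂ t ht), fun t ht => ?_⟩
  have hfi := hf.intervalIntegrable t ht
  have hgi := hg.intervalIntegrable t ht
  -- `e₁` and `e₂` leave boundary terms and two triangle integrals of opposite sign, which cancel by
  -- Fubini.
  have e₁ : ∫ s in (0 : ℝ)..t, L (f' s) (g s)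
      = L (f t - f 0) (g 0) + ∫ s in (0 : ℝ)..t, L (f' s) (∫ r in (0 : ℝ)..s, g' r) := by
    have hprim : ContinuousOn (fun s => ∫ r in (0 : ℝ)..s, g' r) (Set.Icc 0 t) := by
      simpa [Set.uIcc_of_le ht] using intervalIntegral.continuousOn_primitive_interval'
        hgi Set.left_mem_uIcc
    rw [hf.sub_eq_integral le_rfl ht, ← L.flip_apply,
      ← ContinuousLinearMap.intervalIntegral_comp_comm _ hfi,
      ← intervalIntegral.integral_add (g := fun s => L (f' s) (∫ r in (0 : ℝ)..s, g' r))
        (intervalIntegrable_bilin L.flip ht continuousOn_const hfi)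
        (intervalIntegrable_bilin L.flip ht hprim hfi)]
    refine intervalIntegral.integral_congr fun s hs => ?_
    rw [Set.uIcc_of_le ht] at hs
    rw [hg.eq_add_integral s hs.1, map_add, L.flip_apply]
  have e₂ : ∫ s in (0 : ℝ)..t, L (f s) (g' s)
      = L (f t) (g t - g 0) - ∫ r in (0 : ℝ)..t, L (∫ s in r..t, f' s) (g' r) := by
    have hprim : ContinuousOn (fun r => ∫ s in r..t, f' s) (Set.Icc 0 t) := by
      refine ((continuousOn_const (c := f t)).sub (hf.continuousOn_Icc ht)).congr fun r hr => ?_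
      exact (hf.sub_eq_integral hr.1 ht).symm
    rw [hg.sub_eq_integral le_rfl ht,
      ← ContinuousLinearMap.intervalIntegral_comp_comm _ hgi,
      ← intervalIntegral.integral_sub (intervalIntegrable_bilin L ht continuousOn_const hgi)
        (intervalIntegrable_bilin L ht hprim hgi)]
    refine intervalIntegral.integral_congr fun s hs => ?_
    rw [Set.uIcc_of_le ht] at hs
    simp [← hf.sub_eq_integral hs.1 ht]
  rw [intervalIntegral.integral_add (i₁ t ht) (i₂ t ht), e₁, e₂,
    integral_bilin_triangle L ht hfi hgi]
  simp only [map_sub, sub_apply]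
  abel

/-- Exponential decay from the differential inequality `V' ≤ -ξ V`. -/
theorem HasIntegralDeriv.le_exp {V V' : ℝ → ℝ} {ξ : ℝ} (hV : HasIntegralDeriv V V')
    (h : ∀ t, 0 ≤ t → V' t ≤ -ξ * V t) {t : ℝ} (ht : 0 ≤ t) : V t ≤ V 0 * Real.exp (-ξ * t) := by
  -- `V` need not be differentiable, so Grönwall is applied to difference quotients from the right:
  -- these are averages of `V'`, hence at most averages of the continuous function `-ξ V`.
  have key := le_gronwallBound_of_liminf_deriv_right_le (f := V) (f' := fun s => -ξ * V s)
    (δ := V 0) (K := -ξ) (ε := 0) (a := 0) (b := t) (hV.continuousOn_Icc ht) ?_ le_rfl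
    (fun x _ => by simp) t ⟨ht, le_rfl⟩
  · simpa [gronwallBound_ε0] using key
  · intro x hx r hr
    apply Eventually.frequently
    have hc : ContinuousWithinAt (fun s => -ξ * V s) (Set.Ici 0) x :=
      continuousWithinAt_const.mul (hV.continuousOn x hx.1)
    obtain ⟨r', hr', hr'r⟩ := exists_between hr
    have hev : ∀ᶠ s in 𝓝[>] x, -ξ * V s < r' := by
      have := hc.mono (Set.Ici_subset_Ici.2 hx.1) |>.mono Set.Ioi_subset_Ici_self
      exact this.eventually (gt_mem_nhds hr')
    obtain ⟨y, hy, hys⟩ := mem_nhdsGT_iff_exists_Ioc_subset.1 hev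
    filter_upwards [Ioc_mem_nhdsGT hy] with z hz
    have hz0 : 0 ≤ z := hx.1.trans hz.1.le
    have hxz : 0 < z - x := by linarith [hz.1]
    rw [hV.sub_eq_integral hx.1 hz0]
    have : ∫ s in x..z, V' s ≤ ∫ s in x..z, r' := by
      refine intervalIntegral.integral_mono_on_of_le_Ioo hz.1.le (hV.intervalIntegrable' hx.1 hz0)
        (by simp) fun s hs => ?_
      exact (h s (hx.1.trans hs.1.le)).trans (le_of_lt (hys ⟨hs.1, hs.2.le.trans hz.2⟩))
    rw [intervalIntegral.integral_const, smul_eq_mul] at this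
    calc (z - x)⁻¹ * ∫ s in x..z, V' s ≤ (z - x)⁻¹ * ((z - x) * r') := by gcongr
      _ = r' := by field_simp
      _ < r := hr'r

end IntegralDeriv

/-! ### Bounds for exponentials of bounded operators. -/

section OperatorExp

variable {E : Type*} [NormedAddCommGroup E] [NormedSpace ℝ E]

theorem norm_exp_clm_le (A : E →L[ℝ] E) : ‖NormedSpace.exp A‖ ≤ Real.exp ‖A‖ := by
  -- In the zero space `‖1‖ = 0`, so `norm_pow_le` is reserved for the nontrivial case; `n = 0` is
  -- allowed.
  rcases subsingleton_or_nontrivial E with hE | hE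
  · rw [Subsingleton.elim (NormedSpace.exp A) 0, norm_zero]
    positivity
  · rw [congrFun (NormedSpace.exp_eq_tsum ℝ) A, Real.exp_eq_exp_ℝ,
      congrFun (NormedSpace.exp_eq_tsum ℝ) ‖A‖]
    have hs := NormedSpace.expSeries_summable' (𝕂 := ℝ) ‖A‖
    refine tsum_of_norm_bounded hs.hasSum fun n => ?_
    rw [norm_smul, norm_inv, RCLike.norm_natCast, smul_eq_mul]
    gcongr
    exact norm_pow_le A n

theorem norm_exp_smul_le {A : E →L[ℝ] E} {M D s : ℝ} (hA : ‖A‖ ≤ M) (hs : |s| ≤ D) :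
    ‖NormedSpace.exp (s • A)‖ ≤ Real.exp (D * M) := by
  refine (norm_exp_clm_le _).trans (Real.exp_le_exp.2 ?_)
  rw [norm_smul, Real.norm_eq_abs]
  exact mul_le_mul hs hA (norm_nonneg _) ((abs_nonneg s).trans hs)

variable [CompleteSpace E]

theorem exp_smul_mul_exp_smul (A : E →L[ℝ] E) (s t : ℝ) :
    NormedSpace.exp (s • A) * NormedSpace.exp (t • A) = NormedSpace.exp ((s + t) • A) := by
  let _ : NormedAlgebra ℚ (E →L[ℝ] E) := .restrictScalars ℚ ℝ _
  rw [add_smul, NormedSpace.exp_add_of_commute]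
  exact ((Commute.refl A).smul_left s).smul_right t

theorem continuous_exp_smul (A : E →L[ℝ] E) :
    Continuous fun s : ℝ => NormedSpace.exp (s • A) :=
  continuous_iff_continuousAt.2 fun t => (hasDerivAt_exp_smul_const (𝕂 := ℝ) A t).continuousAt

/-- Duhamel's argument: `e^{rA} e^{(s-r)A'}` joins the two exponentials as `r` runs over `[0, s]`,
with derivative `e^{rA} (A - A') e^{(s-r)A'}`. -/
theorem norm_exp_smul_sub_exp_smul_le {A A' : E →L[ℝ] E} {M D s : ℝ} (hA : ‖A‖ ≤ M)
    (hA' : ‖A'‖ ≤ M) (hs : 0 ≤ s) (hsD : s ≤ D) :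
    ‖NormedSpace.exp (s • A) - NormedSpace.exp (s • A')‖
      ≤ D * Real.exp (D * M) ^ 2 * ‖A - A'‖ := by
  set φ : ℝ → E →L[ℝ] E := fun r => NormedSpace.exp (r • A) * NormedSpace.exp ((s - r) • A')
  have hφ : ∀ r, HasDerivAt φ
      (NormedSpace.exp (r • A) * (A - A') * NormedSpace.exp ((s - r) • A')) r := by
    intro r
    have h₁ := hasDerivAt_exp_smul_const (𝕂 := ℝ) A r
    have h₂ := (hasDerivAt_exp_smul_const' (𝕂 := ℝ) A' (s - r)).scomp r
      ((hasDerivAt_id r).const_sub s)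
    refine (h₁.mul h₂).congr_deriv ?_
    simp only [Function.comp_def, neg_smul, one_smul]
    noncomm_ring
  have key := norm_image_sub_le_of_norm_deriv_le_segment' (a := 0) (b := s)
    (C := Real.exp (D * M) ^ 2 * ‖A - A'‖) (fun r _ => (hφ r).hasDerivWithinAt) ?_ s ⟨hs, le_rfl⟩
  · have e : φ s - φ 0 = NormedSpace.exp (s • A) - NormedSpace.exp (s • A') := by
      simp [φ, NormedSpace.exp_zero]
    rw [e] at key
    refine key.trans ?_
    rw [sub_zero, mul_comm, ← mul_assoc]
    gcongr
  · intro r hr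
    have h₁ := norm_exp_smul_le (s := r) (D := D) hA (by rw [abs_of_nonneg hr.1]; linarith [hr.2])
    have h₂ := norm_exp_smul_le (s := s - r) (D := D) hA'
      (by rw [abs_of_nonneg (by linarith [hr.2])]; linarith [hr.1])
    calc _ ≤ ‖NormedSpace.exp (r • A)‖ * ‖A - A'‖ * ‖NormedSpace.exp ((s - r) • A')‖ :=
          norm_mul₃_le
      _ ≤ Real.exp (D * M) * ‖A - A'‖ * Real.exp (D * M) := by gcongr
      _ = _ := by ring

end OperatorExp

/-! ### The `L²` norm of the input window. -/

section InputNorm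

/-- The `L²` norm of the input over `[t - D, t]`. -/
noncomputable def inputNorm (D : ℝ) (U : ℝ → ℝ) (t : ℝ) : ℝ := √(∫ θ in (t - D)..t, U θ ^ 2)

theorem inputNorm_nonneg (D : ℝ) (U : ℝ → ℝ) (t : ℝ) : 0 ≤ inputNorm D U t := Real.sqrt_nonneg _

theorem sq_inputNorm {D : ℝ} (hD : 0 ≤ D) (U : ℝ → ℝ) (t : ℝ) :
    inputNorm D U t ^ 2 = ∫ θ in (t - D)..t, U θ ^ 2 :=
  Real.sq_sqrt (intervalIntegral.integral_nonneg (by linarith) fun _ _ => sq_nonneg _)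

theorem intervalIntegrable_of_memLp {U : ℝ → ℝ} {a b : ℝ} (hab : a ≤ b)
    (hU : MemLp U 2 (volume.restrict (Set.Ioc a b))) : IntervalIntegrable U volume a b := by
  rw [intervalIntegrable_iff_integrableOn_Ioc_of_le hab]
  exact hU.integrable one_le_two

theorem intervalIntegrable_sq_of_memLp {U : ℝ → ℝ} {a b : ℝ} (hab : a ≤ b)
    (hU : MemLp U 2 (volume.restrict (Set.Ioc a b))) :
    IntervalIntegrable (fun s => U s ^ 2) volume a b := by
  rw [intervalIntegrable_iff_integrableOn_Ioc_of_le hab]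
  exact hU.integrable_sq

/-- Cauchy–Schwarz, from the nonnegativity of `∫ (|U| - m / D)²` with `m / D` the mean of `|U|`. -/
theorem integral_abs_le_inputNorm {D : ℝ} (hD : 0 < D) {U : ℝ → ℝ} {t : ℝ}
    (hU : MemLp U 2 (volume.restrict (Set.Ioc (t - D) t))) :
    ∫ θ in (t - D)..t, |U θ| ≤ √D * inputNorm D U t := by
  have h₁ := (intervalIntegrable_of_memLp (by linarith) hU).abs
  have h₂ := intervalIntegrable_sq_of_memLp (by linarith) hU
  set m := ∫ θ in (t - D)..t, |U θ|
  rw [inputNorm, ← Real.sqrt_mul hD.le]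
  refine Real.le_sqrt_of_sq_le ?_
  have key : 0 ≤ ∫ θ in (t - D)..t, (U θ ^ 2 - 2 * (m / D) * |U θ| + (m / D) ^ 2) := by
    refine intervalIntegral.integral_nonneg (by linarith) fun θ _ => ?_
    nlinarith [sq_nonneg (|U θ| - m / D), sq_abs (U θ)]
  rw [intervalIntegral.integral_add (h₂.sub (h₁.const_mul _)) (by simp),
    intervalIntegral.integral_sub h₂ (h₁.const_mul _), intervalIntegral.integral_const_mul,
    intervalIntegral.integral_const, smul_eq_mul] at key
  change 0 ≤ (∫ θ in (t - D)..t, U θ ^ 2) - 2 * (m / D) * m + (t - (t - D)) * (m / D) ^ 2 at key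
  have e : (∫ θ in (t - D)..t, U θ ^ 2) - 2 * (m / D) * m + (t - (t - D)) * (m / D) ^ 2
      = (∫ θ in (t - D)..t, U θ ^ 2) - m ^ 2 / D := by
    field_simp
    ring
  rw [e, sub_nonneg, div_le_iff₀ hD] at key
  linarith

theorem norm_integral_smul_le {E : Type*} [NormedAddCommGroup E] [NormedSpace ℝ E] {D : ℝ}
    (hD : 0 < D) {U : ℝ → ℝ} {t C : ℝ} (hC : 0 ≤ C) {φ : ℝ → E}
    (hU : MemLp U 2 (volume.restrict (Set.Ioc (t - D) t)))
    (hφ : ∀ θ ∈ Set.Ioc (t - D) t, ‖φ θ‖ ≤ C) :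
    ‖∫ θ in (t - D)..t, U θ • φ θ‖ ≤ C * (√D * inputNorm D U t) := by
  have h₁ := (intervalIntegrable_of_memLp (by linarith) hU).abs
  calc _ ≤ ∫ θ in (t - D)..t, C * |U θ| := by
        refine intervalIntegral.norm_integral_le_of_norm_le (by linarith)
          (ae_of_all _ fun θ hθ => ?_) (h₁.const_mul C)
        rw [norm_smul, mul_comm, Real.norm_eq_abs]
        exact mul_le_mul_of_nonneg_right (hφ θ hθ) (abs_nonneg _)
    _ = C * ∫ θ in (t - D)..t, |U θ| := intervalIntegral.integral_const_mul _ _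
    _ ≤ _ := mul_le_mul_of_nonneg_left (integral_abs_le_inputNorm hD hU) hC

end InputNorm

/-! ### The predictor: bounds, dependence on the mode, and evolution. -/

section Predictor

variable {E : Type*} [NormedAddCommGroup E] [NormedSpace ℝ E]

/-- The exact predictor of the mode `(A, b)`, in operator form. -/
noncomputable def opPredictor (D : ℝ) (A : E →L[ℝ] E) (b : E) (x : ℝ → E) (U : ℝ → ℝ) (t : ℝ) :
    E :=
  NormedSpace.exp (D • A) (x t) + ∫ θ in (t - D)..t, U θ • NormedSpace.exp ((t - θ) • A) b

variable [CompleteSpace E]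

/-- One constant serves all modes of norm at most `M`. The first two bounds let state and predictor
be exchanged, modulo the input norm; the third controls the error of using the wrong mode. -/
theorem exists_opPredictor_bounds (E : Type*) [NormedAddCommGroup E] [NormedSpace ℝ E]
    [CompleteSpace E] {D M : ℝ} (hD : 0 < D) (hM : 1 ≤ M) :
    ∃ C : ℝ, 1 ≤ C ∧ ∀ (A : E →L[ℝ] E) (b : E) (x : ℝ → E) (U : ℝ → ℝ) (t : ℝ),
      ‖A‖ ≤ M → ‖b‖ ≤ M → MemLp U 2 (volume.restrict (Set.Ioc (t - D) t)) →
      ‖opPredictor D A b x U t‖ ≤ C * (‖x t‖ + inputNorm D U t) ∧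
      ‖x t‖ + inputNorm D U t ≤ C * (‖opPredictor D A b x U t‖ + inputNorm D U t) ∧
      ∀ (A' : E →L[ℝ] E) (b' : E) (ε : ℝ), ‖A'‖ ≤ M → ‖b'‖ ≤ M → ‖A - A'‖ ≤ ε → ‖b - b'‖ ≤ ε →
        ‖opPredictor D A b x U t - opPredictor D A' b' x U t‖
          ≤ C * ε * (‖x t‖ + inputNorm D U t) := by
  set G := Real.exp (D * M) with hGdef
  have hG : 1 ≤ G := Real.one_le_exp (by positivity)
  set S := √D with hS
  have hS0 : 0 ≤ S := Real.sqrt_nonneg _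
  have hGG : G ≤ G ^ 2 := by nlinarith
  have hGM : G ^ 2 ≤ G ^ 2 * M := by nlinarith
  -- `G ^ 2` comes from products of two exponentials, `M` from `b`, `1 + S` from Cauchy–Schwarz, `1
  -- + D` from the Duhamel bound.
  refine ⟨(1 + D) * (G ^ 2 * M) * (1 + S), ?_, fun A b x U t hA hb hU => ?_⟩
  · have : 1 ≤ G ^ 2 * M := by linarith
    have h2 : 1 ≤ (1 + D) * (G ^ 2 * M) := by nlinarith
    nlinarith
  set u := inputNorm D U t with hu
  have hu0 : 0 ≤ u := inputNorm_nonneg _ _ _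
  have hexp : ∀ (A : E →L[ℝ] E), ‖A‖ ≤ M → ∀ θ ∈ Set.Ioc (t - D) t,
      ‖NormedSpace.exp ((t - θ) • A)‖ ≤ G := fun A hA θ hθ =>
    norm_exp_smul_le hA (by rw [abs_of_nonneg (by linarith [hθ.2])]; linarith [hθ.1])
  have hI : ‖∫ θ in (t - D)..t, U θ • NormedSpace.exp ((t - θ) • A) b‖ ≤ G * M * (S * u) := by
    refine norm_integral_smul_le hD (by positivity) hU fun θ hθ => ?_
    refine (ContinuousLinearMap.le_opNorm _ _).trans ?_
    exact mul_le_mul (hexp A hA θ hθ) hb (norm_nonneg _) (by positivity)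
  have hx0 := norm_nonneg (x t)
  have hD' : |D| ≤ D := (abs_of_pos hD).le
  have hSu : 0 ≤ S * u := by positivity
  have hbase : G ^ 2 * M * (1 + S) ≤ (1 + D) * (G ^ 2 * M) * (1 + S) := by
    have : 0 ≤ G ^ 2 * M * (1 + S) := by positivity
    nlinarith
  refine ⟨?_, ?_, fun A' b' ε hA' hb' hAA' hbb' => ?_⟩
  · have h₁ : ‖NormedSpace.exp (D • A) (x t)‖ ≤ G * ‖x t‖ :=
      (ContinuousLinearMap.le_opNorm _ _).trans (by gcongr; exact norm_exp_smul_le hA hD')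
    calc _ ≤ G * ‖x t‖ + G * M * (S * u) := (norm_add_le _ _).trans (add_le_add h₁ hI)
      _ ≤ (G ^ 2 * M * (1 + S)) * (‖x t‖ + u) := by
        have e1 : G * ‖x t‖ ≤ G ^ 2 * M * ‖x t‖ := by gcongr; linarith
        have e2 : G * M * (S * u) ≤ G ^ 2 * M * (S * u) := by gcongr
        have e3 : 0 ≤ G ^ 2 * M * (S * ‖x t‖ + u) := by positivity
        linarith
      _ ≤ _ := by gcongr
  · set p := opPredictor D A b x U t with hp
    have ex : x t = NormedSpace.exp ((-D) • A)
        (p - ∫ θ in (t - D)..t, U θ • NormedSpace.exp ((t - θ) • A) b) := by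
      rw [hp, opPredictor, add_sub_cancel_right, ← mul_apply_eq_comp,
        exp_smul_mul_exp_smul]
      simp [NormedSpace.exp_zero]
    have h₁ : ‖x t‖ ≤ G * (‖p‖ + G * M * (S * u)) := by
      conv_lhs => rw [ex]
      refine (ContinuousLinearMap.le_opNorm _ _).trans ?_
      gcongr
      · exact norm_exp_smul_le hA (by rwa [abs_neg])
      · exact (norm_sub_le _ _).trans (by gcongr)
    have hp0 := norm_nonneg p
    calc _ ≤ G * (‖p‖ + G * M * (S * u)) + u := by gcongr
      _ ≤ (G ^ 2 * M * (1 + S)) * (‖p‖ + u) := by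
        have e1 : G * ‖p‖ ≤ G ^ 2 * M * ‖p‖ := by gcongr; linarith
        have e2 : 1 * u ≤ G ^ 2 * M * u := by gcongr; linarith
        have e3 : 0 ≤ G ^ 2 * M * (S * ‖p‖) := by positivity
        linarith
      _ ≤ _ := by gcongr
  · have hε : 0 ≤ ε := (norm_nonneg _).trans hAA'
    have hint : ∀ (A : E →L[ℝ] E) (b : E), IntervalIntegrable
        (fun θ => U θ • NormedSpace.exp ((t - θ) • A) b) volume (t - D) t := by
      intro A b
      refine (intervalIntegrable_of_memLp (by linarith) hU).smul_continuousOn ?_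
      exact (((continuous_exp_smul A).comp (continuous_const.sub continuous_id)).clm_apply
        continuous_const).continuousOn
    have e : opPredictor D A b x U t - opPredictor D A' b' x U t
        = (NormedSpace.exp (D • A) - NormedSpace.exp (D • A')) (x t)
          + ∫ θ in (t - D)..t, U θ • (NormedSpace.exp ((t - θ) • A) b
              - NormedSpace.exp ((t - θ) • A') b') := by
      simp only [smul_sub]
      rw [intervalIntegral.integral_sub (hint A b) (hint A' b'), opPredictor, opPredictor,
        sub_apply]
      abel
    have h₁ : ‖(NormedSpace.exp (D • A) - NormedSpace.exp (D • A')) (x t)‖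
        ≤ D * G ^ 2 * ε * ‖x t‖ := by
      refine (ContinuousLinearMap.le_opNorm _ _).trans ?_
      gcongr
      refine (norm_exp_smul_sub_exp_smul_le hA hA' hD.le le_rfl).trans ?_
      gcongr
    have h₂ : ‖∫ θ in (t - D)..t, U θ • (NormedSpace.exp ((t - θ) • A) b
        - NormedSpace.exp ((t - θ) • A') b')‖ ≤ (D * G ^ 2 * ε * M + G * ε) * (S * u) := by
      refine norm_integral_smul_le hD (by positivity) hU fun θ hθ => ?_
      have e' : NormedSpace.exp ((t - θ) • A) b - NormedSpace.exp ((t - θ) • A') b'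
          = (NormedSpace.exp ((t - θ) • A) - NormedSpace.exp ((t - θ) • A')) b
            + NormedSpace.exp ((t - θ) • A') (b - b') := by
        rw [sub_apply, map_sub]
        abel
      rw [e']
      refine (norm_add_le _ _).trans (add_le_add ?_ ?_)
      · refine (ContinuousLinearMap.le_opNorm _ _).trans ?_
        gcongr
        refine (norm_exp_smul_sub_exp_smul_le (D := D) hA hA' (by linarith [hθ.2])
          (by linarith [hθ.1])).trans ?_
        gcongr
      · refine (ContinuousLinearMap.le_opNorm _ _).trans ?_
        gcongr
        exact hexp A' hA' θ hθ
    rw [e]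
    calc _ ≤ D * G ^ 2 * ε * ‖x t‖ + (D * G ^ 2 * ε * M + G * ε) * (S * u) :=
          (norm_add_le _ _).trans (add_le_add h₁ h₂)
      _ ≤ (1 + D) * (G ^ 2 * M) * ε * ‖x t‖ + (1 + D) * (G ^ 2 * M) * ε * (S * u) := by
        have e1 : D * G ^ 2 * ε ≤ (1 + D) * (G ^ 2 * M) * ε := by gcongr; linarith
        have e2 : G * ε ≤ G ^ 2 * M * ε := by gcongr; linarith
        have e3 : D * G ^ 2 * ε * M + G * ε ≤ (1 + D) * (G ^ 2 * M) * ε := by linarith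
        gcongr
      _ ≤ _ := by
        have : 0 ≤ (1 + D) * (G ^ 2 * M) * ε * (u + S * ‖x t‖) := by positivity
        linarith

/-- The delayed input cancels: `e^{DA}` applied to `U(t-D) b` in `x'` is exactly the boundary term
lost at the left end of the window. -/
theorem HasIntegralDeriv.opPredictor {D : ℝ} (hD : 0 ≤ D) {A : E →L[ℝ] E} {b : E} {x d : ℝ → E}
    {U : ℝ → ℝ} (hU : ∀ t, 0 ≤ t → IntervalIntegrable U volume (-D) t)
    (hx : HasIntegralDeriv x fun t => A (x t) + U (t - D) • b + d t) :
    HasIntegralDeriv (opPredictor D A b x U)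
      (fun t => A (opPredictor D A b x U t) + U t • b + NormedSpace.exp (D • A) (d t)) := by
  -- Writing `e^{(t-θ)A} = e^{tA} e^{-θA}` frees the integrand of `t`, so the product rule applies.
  have hy := HasIntegralDeriv.window (h := fun θ => U θ • NormedSpace.exp ((-θ) • A) b) hD
    fun t ht => (hU t ht).smul_continuousOn
      (((continuous_exp_smul A).comp continuous_neg).clm_apply continuous_const).continuousOn
  have he : HasIntegralDeriv (fun t : ℝ => NormedSpace.exp (t • A))
      (fun t => A * NormedSpace.exp (t • A)) :=
    .of_hasDerivAt (fun t => hasDerivAt_exp_smul_const' (𝕂 := ℝ) A t)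
      (continuous_const.mul (continuous_exp_smul A))
  have h := (hx.clm_comp (NormedSpace.exp (D • A))).add
    (he.bilin hy (ContinuousLinearMap.id ℝ (E →L[ℝ] E)))
  have hexp : ∀ (s t : ℝ) (v : E), NormedSpace.exp (s • A) (NormedSpace.exp (t • A) v)
      = NormedSpace.exp ((s + t) • A) v := fun s t v => by
    rw [← mul_apply_eq_comp, exp_smul_mul_exp_smul]
  have hcomm : ∀ v, A (NormedSpace.exp (D • A) v) = NormedSpace.exp (D • A) (A v) := fun v => by
    have : Commute A (NormedSpace.exp (D • A)) :=
      ((Commute.refl A).smul_right D).exp_right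
    exact congrArg (fun T : E →L[ℝ] E => T v) this.eq
  have e : ∀ t, 0 ≤ t → SwitchedDelay.opPredictor D A b x U t = NormedSpace.exp (D • A) (x t)
      + NormedSpace.exp (t • A) (∫ θ in (t - D)..t, U θ • NormedSpace.exp ((-θ) • A) b) := by
    intro t ht
    have hi : IntervalIntegrable (fun θ => U θ • NormedSpace.exp ((-θ) • A) b) volume (t - D) t :=
      ((hU t ht).mono_set (by
        rw [Set.uIcc_of_le (by linarith), Set.uIcc_of_le (by linarith)]
        exact Set.Icc_subset_Icc_left (by linarith))).smul_continuousOn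
      (((continuous_exp_smul A).comp continuous_neg).clm_apply continuous_const).continuousOn
    rw [← ContinuousLinearMap.intervalIntegral_comp_comm _ hi, SwitchedDelay.opPredictor]
    congr 1
    refine intervalIntegral.integral_congr fun θ _ => ?_
    simp only [map_smul, hexp, sub_eq_add_neg]
  refine h.congr (fun t ht => e t ht) fun t ht => ?_
  rw [e t ht]
  simp only [ContinuousLinearMap.id_apply, mul_apply_eq_comp, map_add, map_sub,
    map_smul, hexp, hcomm]
  have e₁ : t + -(t - D) = D := by ring
  rw [e₁]
  simp [NormedSpace.exp_zero]
  abel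

end Predictor

/-! ### Choice of the Lyapunov constants. -/

/-- The quadratic estimate behind the Lyapunov functional `⟪p, P p⟫ + a ∫ e^{θ-t} U(θ)²`: for small
`ε` its derivative is bounded by a negative definite form in `(p, u)`. -/
theorem exists_lyapunov_constants {q N M G C κ : ℝ} (hq : 0 < q) (hN : 0 ≤ N) (hM : 1 ≤ M)
    (hG : 0 ≤ G) (hC : 0 ≤ C) (hκ : 0 < κ) :
    ∃ a η δ : ℝ, 0 < a ∧ 0 < η ∧ 0 < δ ∧ ∀ ε p u v w d r W : ℝ, 0 ≤ ε → ε ≤ δ → 0 ≤ p → 0 ≤ u →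
      0 ≤ v → 0 ≤ w → w ≤ C * ε * (p + u) → d ≤ C * ε * (p + u + v) → |r| ≤ M * p + w →
      κ * u ^ 2 ≤ W →
      -q * p ^ 2 + 2 * N * p * (M * w + G * d) + a * (-W + (r ^ 2 - κ * v ^ 2))
        ≤ -η * (p ^ 2 + u ^ 2) := by
  -- With this `a`, the part `2 M² p²` of `r²` costs exactly half of the dissipation `q p²`.
  set a := q / (4 * M ^ 2) with ha
  have ha0 : 0 < a := by positivity
  set m := min (q / 2) (a * κ) with hm
  have hm0 : 0 < m := by positivity
  set K := 4 * N * C * (M + G) + 4 * a * C ^ 2 with hK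
  have hK0 : 0 ≤ K := by positivity
  -- `m` is the margin left without perturbation and `K ε` the total perturbation. The bound `1`
  -- gives `ε² ≤ ε`; the other gives `K ε ≤ m / 2`.
  refine ⟨a, m / 2, min 1 (m / (2 * K + 1)), ha0, by positivity, by positivity, ?_⟩
  intro ε p u v w d r W hε hεδ hp hu hv hw hwC hdC hr hW
  have hε1 : ε ≤ 1 := hεδ.trans (min_le_left _ _)
  set S := p ^ 2 + u ^ 2 + v ^ 2 with hS
  have hS0 : 0 ≤ S := by positivity
  have hKε : K * ε ≤ m / 2 := by
    have h1 : ε ≤ m / (2 * K + 1) := hεδ.trans (min_le_right _ _)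
    rw [le_div_iff₀ (by positivity)] at h1
    linarith
  have hpS : p * (p + u + v) ≤ 2 * S := by
    linarith [sq_nonneg (p - u), sq_nonneg (p - v), sq_nonneg u, sq_nonneg v,
      (by ring : 2 * (p * (p + u + v)) + (p - u) ^ 2 + (p - v) ^ 2 = 4 * p ^ 2 + u ^ 2 + v ^ 2)]
  have h₁ : 2 * N * p * (M * w + G * d) ≤ 4 * N * C * (M + G) * ε * S := by
    have hwC' : w ≤ C * ε * (p + u + v) := hwC.trans (mul_le_mul_of_nonneg_left (by linarith) (by positivity))
    calc 2 * N * p * (M * w + G * d)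
        ≤ 2 * N * p * (M * (C * ε * (p + u + v)) + G * (C * ε * (p + u + v))) := by gcongr
      _ = 2 * N * C * (M + G) * ε * (p * (p + u + v)) := by ring
      _ ≤ 2 * N * C * (M + G) * ε * (2 * S) := by gcongr
      _ = _ := by ring
  have h₂ : r ^ 2 ≤ 2 * M ^ 2 * p ^ 2 + 4 * C ^ 2 * ε * S := by
    have e1 : r ^ 2 ≤ (M * p + w) ^ 2 := by
      rw [← sq_abs]
      gcongr
    have e2 : (M * p + w) ^ 2 ≤ 2 * M ^ 2 * p ^ 2 + 2 * w ^ 2 := by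
      linarith [sq_nonneg (M * p - w), (by ring : (M * p + w) ^ 2 + (M * p - w) ^ 2
        = 2 * M ^ 2 * p ^ 2 + 2 * w ^ 2)]
    have e3 : w ^ 2 ≤ (C * ε * (p + u)) ^ 2 := by gcongr
    have e4 : (p + u) ^ 2 ≤ 2 * S := by
      linarith [sq_nonneg (p - u), sq_nonneg v,
        (by ring : (p + u) ^ 2 + (p - u) ^ 2 = 2 * (p ^ 2 + u ^ 2))]
    have e5 : ε ^ 2 ≤ ε := pow_le_of_le_one hε hε1 two_ne_zero
    have e6 : (C * ε * (p + u)) ^ 2 ≤ C ^ 2 * ε * (2 * S) := by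
      calc (C * ε * (p + u)) ^ 2 = C ^ 2 * ε ^ 2 * (p + u) ^ 2 := by ring
        _ ≤ C ^ 2 * ε * (2 * S) := by gcongr
    linarith
  have h₃ : a * (2 * M ^ 2 * p ^ 2) = q / 2 * p ^ 2 := by
    rw [ha]
    field_simp
    ring
  have h₄ : m * S ≤ q / 2 * p ^ 2 + a * κ * u ^ 2 + a * κ * v ^ 2 := by
    rw [hS, mul_add, mul_add]
    gcongr
    exacts [min_le_left _ _, min_le_right _ _, min_le_right _ _]
  have h₅ : a * r ^ 2 ≤ a * (2 * M ^ 2 * p ^ 2) + 4 * a * C ^ 2 * ε * S := by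
    calc _ ≤ a * (2 * M ^ 2 * p ^ 2 + 4 * C ^ 2 * ε * S) := by gcongr
      _ = _ := by ring
  have h₆ : a * (κ * u ^ 2) ≤ a * W := by gcongr
  have h₇ : K * ε * S ≤ m / 2 * S := by gcongr
  have h₈ : m / 2 * (p ^ 2 + u ^ 2) ≤ m / 2 * S := by
    gcongr
    linarith [sq_nonneg v]
  have h₉ : K * ε * S = 4 * N * C * (M + G) * ε * S + 4 * a * C ^ 2 * ε * S := by
    rw [hK]
    ring
  linarith

/-! ### The exponentially weighted input energy. -/

section Window

theorem memLp_window {D : ℝ} {U : ℝ → ℝ}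
    (hU : ∀ T, 0 ≤ T → MemLp U 2 (volume.restrict (Set.Icc (-D) T))) {t : ℝ} (ht : 0 ≤ t) :
    MemLp U 2 (volume.restrict (Set.Ioc (t - D) t)) :=
  (hU t ht).mono_measure (Measure.restrict_mono
    (Set.Ioc_subset_Icc_self.trans (Set.Icc_subset_Icc_left (by linarith))) le_rfl)

theorem memLp_Ioc {D : ℝ} {U : ℝ → ℝ}
    (hU : ∀ T, 0 ≤ T → MemLp U 2 (volume.restrict (Set.Icc (-D) T))) {t : ℝ} (ht : 0 ≤ t) :
    MemLp U 2 (volume.restrict (Set.Ioc (-D) t)) :=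
  (hU t ht).mono_measure (Measure.restrict_mono Set.Ioc_subset_Icc_self le_rfl)

/-- The exponentially weighted input energy `∫_{t-D}^t e^{θ-t} U(θ)² dθ`. -/
noncomputable def weightedEnergy (D : ℝ) (U : ℝ → ℝ) (t : ℝ) : ℝ :=
  ∫ θ in (t - D)..t, Real.exp (θ - t) * U θ ^ 2

variable {D : ℝ} {U : ℝ → ℝ}

theorem weightedEnergy_le (hD : 0 ≤ D) {t : ℝ}
    (hU : MemLp U 2 (volume.restrict (Set.Ioc (t - D) t))) :
    weightedEnergy D U t ≤ inputNorm D U t ^ 2 := by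
  have h₂ := intervalIntegrable_sq_of_memLp (by linarith) hU
  rw [sq_inputNorm hD, weightedEnergy]
  refine intervalIntegral.integral_mono_on (by linarith)
    (h₂.continuousOn_mul (by fun_prop)) h₂ fun θ hθ => ?_
  have : Real.exp (θ - t) ≤ 1 := Real.exp_le_one_iff.2 (by linarith [hθ.2])
  exact mul_le_of_le_one_left (sq_nonneg _) this

theorem le_weightedEnergy (hD : 0 ≤ D) {t : ℝ}
    (hU : MemLp U 2 (volume.restrict (Set.Ioc (t - D) t))) :
    Real.exp (-D) * inputNorm D U t ^ 2 ≤ weightedEnergy D U t := by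
  have h₂ := intervalIntegrable_sq_of_memLp (by linarith) hU
  rw [sq_inputNorm hD, weightedEnergy, ← intervalIntegral.integral_const_mul]
  refine intervalIntegral.integral_mono_on (by linarith) (h₂.const_mul _)
    (h₂.continuousOn_mul (by fun_prop)) fun θ hθ => ?_
  gcongr
  linarith [hθ.1]

/-- Product rule after pulling `e^{-t}` out of the integral; differentiating this factor produces
the damping term. -/
theorem HasIntegralDeriv.weightedEnergy (hD : 0 ≤ D)
    (hU : ∀ T, 0 ≤ T → MemLp U 2 (volume.restrict (Set.Icc (-D) T))) :
    HasIntegralDeriv (weightedEnergy D U) (fun t => -weightedEnergy D U t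
      + (U t ^ 2 - Real.exp (-D) * U (t - D) ^ 2)) := by
  have hy := HasIntegralDeriv.window (h := fun θ => Real.exp θ * U θ ^ 2) hD fun t ht =>
    (intervalIntegrable_sq_of_memLp (by linarith) (memLp_Ioc hU ht)).continuousOn_mul
      Real.continuous_exp.continuousOn
  have he : HasIntegralDeriv (fun t : ℝ => Real.exp (-t)) (fun t => -Real.exp (-t)) :=
    .of_hasDerivAt (fun t => by simpa using (hasDerivAt_neg t).exp) (by fun_prop)
  have h := he.bilin hy (ContinuousLinearMap.mul ℝ ℝ)
  have e : ∀ t, SwitchedDelay.weightedEnergy D U t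
      = Real.exp (-t) * ∫ θ in (t - D)..t, Real.exp θ * U θ ^ 2 := by
    intro t
    rw [← intervalIntegral.integral_const_mul, SwitchedDelay.weightedEnergy]
    refine intervalIntegral.integral_congr fun θ _ => ?_
    rw [← mul_assoc, ← Real.exp_add, neg_add_eq_sub]
  refine h.congr (fun t _ => e t) fun t _ => ?_
  simp only [ContinuousLinearMap.mul_apply']
  rw [e t, mul_sub, ← mul_assoc, ← mul_assoc, ← Real.exp_add, ← Real.exp_add]
  have e₁ : -t + (t - D) = -D := by ring
  rw [e₁, neg_add_cancel, Real.exp_zero]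
  ring

end Window

/-! ### Lyapunov decay of the perturbed nominal loop. -/

section Stability

variable {E : Type*} [NormedAddCommGroup E] [InnerProductSpace ℝ E] [CompleteSpace E]

open scoped RealInnerProductSpace

/-- A loop `x' = A x + U(t-D) b + d`, `U = k p + w`, with `p` the predictor of `(A, b)`, whose
perturbations `d` and `w` are of relative size `ε`, decays exponentially for small `ε`. -/
theorem exists_decay_of_perturbation {D M C q c : ℝ} (hD : 0 < D) (hM : 1 ≤ M) (hC : 1 ≤ C)
    (hq : 0 < q) (hc : 0 < c) (P : E →L[ℝ] E) (hPsymm : ∀ x y, ⟪P x, y⟫ = ⟪x, P y⟫)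
    (hPpos : ∀ x, c * ‖x‖ ^ 2 ≤ ⟪x, P x⟫) :
    ∃ δ ρ ξ : ℝ, 0 < δ ∧ 0 < ρ ∧ 0 < ξ ∧ ∀ (A : E →L[ℝ] E) (b : E) (k : E →L[ℝ] ℝ) (ε : ℝ)
      (x d : ℝ → E) (U w : ℝ → ℝ), ‖A‖ ≤ M → ‖b‖ ≤ M → ‖k‖ ≤ M → 0 ≤ ε → ε ≤ δ →
      (∀ y, 2 * ⟪P y, A y + k y • b⟫ ≤ -q * ‖y‖ ^ 2) →
      (∀ T, 0 ≤ T → MemLp U 2 (volume.restrict (Set.Icc (-D) T))) →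
      HasIntegralDeriv x (fun t => A (x t) + U (t - D) • b + d t) →
      (∀ t, 0 ≤ t → U t = k (opPredictor D A b x U t) + w t) →
      (∀ t, 0 ≤ t → ‖d t‖ ≤ C * ε * (‖x t‖ + inputNorm D U t + |U (t - D)|)) →
      (∀ t, 0 ≤ t → |w t| ≤ C * ε * (‖x t‖ + inputNorm D U t)) →
      ∀ t, 0 ≤ t → ‖x t‖ + inputNorm D U t
        ≤ ρ * (‖x 0‖ + inputNorm D U 0) * Real.exp (-ξ * t) := by
  obtain ⟨C₁, hC₁, hbound⟩ := exists_opPredictor_bounds E hD hM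
  obtain ⟨a, η, δ, ha, hη, hδ, hlyap⟩ := exists_lyapunov_constants (q := q) (N := ‖P‖) (M := M)
    (G := Real.exp (D * M)) (C := C * C₁) (κ := Real.exp (-D)) hq (norm_nonneg _) hM
    (Real.exp_nonneg _) (by positivity) (Real.exp_pos _)
  set m := min c (a * Real.exp (-D)) with hm
  have hm0 : 0 < m := by positivity
  set L := ‖P‖ + a with hL
  have hL0 : 0 < L := by positivity
  set ξ := η / L with hξ
  have hξ0 : 0 < ξ := by positivity
  set ρ := C₁ * √(2 * L / m) * (C₁ + 1) with hρ
  -- The rate is halved because `V` is quadratic in the norms. In `ρ`, the factors `C₁` and `C₁ + 1`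
  -- pass from predictor to state at time `t` and back at time `0`.
  refine ⟨δ, ρ, ξ / 2, hδ, by positivity, by positivity, ?_⟩
  intro A b k ε x d U w hA hb hk hε hεδ hdiss hU hx hfb hd hw
  set p := opPredictor D A b x U with hp
  set u := inputNorm D U with hu
  have hu0 : ∀ t, 0 ≤ u t := inputNorm_nonneg D U
  have hp' := hx.opPredictor hD.le fun t ht =>
    intervalIntegrable_of_memLp (by linarith) (memLp_Ioc hU ht)
  have hW := HasIntegralDeriv.weightedEnergy hD.le hU
  have hV := (hp'.bilin (hp'.clm_comp P) (innerSL ℝ)).add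
    (hW.clm_comp (a • ContinuousLinearMap.id ℝ ℝ))
  set V : ℝ → ℝ := fun t => ⟪p t, P (p t)⟫ + a * weightedEnergy D U t with hVdef
  have hVle : ∀ t, 0 ≤ t → V t ≤ L * (‖p t‖ ^ 2 + u t ^ 2) := by
    intro t ht
    have h₁ : ⟪p t, P (p t)⟫ ≤ ‖P‖ * ‖p t‖ ^ 2 := by
      calc _ ≤ ‖p t‖ * ‖P (p t)‖ := real_inner_le_norm _ _
        _ ≤ ‖p t‖ * (‖P‖ * ‖p t‖) := by gcongr; exact P.le_opNorm _
        _ = _ := by ring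
    have h₂ : a * weightedEnergy D U t ≤ a * u t ^ 2 := by
      gcongr
      exact weightedEnergy_le hD.le (memLp_window hU ht)
    have h₃ : 0 ≤ ‖P‖ * u t ^ 2 := by positivity
    have h₄ : 0 ≤ a * ‖p t‖ ^ 2 := by positivity
    simp only [hVdef, hL]
    linarith
  have hleV : ∀ t, 0 ≤ t → m * (‖p t‖ ^ 2 + u t ^ 2) ≤ V t := by
    intro t ht
    have h₁ := hPpos (p t)
    have h₂ : a * (Real.exp (-D) * u t ^ 2) ≤ a * weightedEnergy D U t := by
      gcongr
      exact le_weightedEnergy hD.le (memLp_window hU ht)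
    have h₃ : m * ‖p t‖ ^ 2 ≤ c * ‖p t‖ ^ 2 := by gcongr; exact min_le_left _ _
    have h₄ : m * u t ^ 2 ≤ a * Real.exp (-D) * u t ^ 2 := by gcongr; exact min_le_right _ _
    simp only [hVdef]
    linarith
  have hdecay : ∀ t, 0 ≤ t → V t ≤ V 0 * Real.exp (-ξ * t) := by
    intro t ht
    refine HasIntegralDeriv.le_exp (V := V) hV ?_ ht
    intro s hs
    obtain ⟨-, hxp, -⟩ := hbound A b x U s hA hb (memLp_window hU hs)
    rw [← hp, ← hu] at hxp
    have hps := norm_nonneg (p s)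
    have hus := hu0 s
    have hw' : |w s| ≤ C * C₁ * ε * (‖p s‖ + u s) := by
      calc _ ≤ C * ε * (‖x s‖ + u s) := hw s hs
        _ ≤ C * ε * (C₁ * (‖p s‖ + u s)) := by gcongr
        _ = _ := by ring
    have hd' : ‖d s‖ ≤ C * C₁ * ε * (‖p s‖ + u s + |U (s - D)|) := by
      have hv : |U (s - D)| ≤ C₁ * |U (s - D)| := le_mul_of_one_le_left (abs_nonneg _) hC₁
      calc _ ≤ C * ε * (‖x s‖ + u s + |U (s - D)|) := hd s hs
        _ ≤ C * ε * (C₁ * (‖p s‖ + u s) + C₁ * |U (s - D)|) := by gcongr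
        _ = _ := by ring
    have hr : |U s| ≤ M * ‖p s‖ + |w s| := by
      rw [hfb s hs]
      refine (abs_add_le _ _).trans ?_
      gcongr
      exact (k.le_opNorm _).trans (by gcongr)
    have key := hlyap ε ‖p s‖ (u s) |U (s - D)| |w s| ‖d s‖ (U s) (weightedEnergy D U s) hε hεδ
      hps hus (abs_nonneg _) (abs_nonneg _) hw' hd' hr
      (le_weightedEnergy hD.le (memLp_window hU hs))
    rw [sq_abs] at key
    have hcross : 2 * ⟪P (p s), w s • b + NormedSpace.exp (D • A) (d s)⟫
        ≤ 2 * ‖P‖ * ‖p s‖ * (M * |w s| + Real.exp (D * M) * ‖d s‖) := by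
      have h₁ : ‖w s • b + NormedSpace.exp (D • A) (d s)‖
          ≤ M * |w s| + Real.exp (D * M) * ‖d s‖ := by
        refine (norm_add_le _ _).trans (add_le_add ?_ ?_)
        · rw [norm_smul, mul_comm, Real.norm_eq_abs]
          gcongr
        · refine (ContinuousLinearMap.le_opNorm _ _).trans ?_
          gcongr
          exact norm_exp_smul_le hA (abs_of_pos hD).le
      have h₂ := P.le_opNorm (p s)
      calc _ ≤ 2 * (‖P (p s)‖ * ‖w s • b + NormedSpace.exp (D • A) (d s)‖) := by
            gcongr
            exact real_inner_le_norm _ _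
        _ ≤ 2 * ((‖P‖ * ‖p s‖) * (M * |w s| + Real.exp (D * M) * ‖d s‖)) := by gcongr
        _ = _ := by ring
    have hform : A (p s) + U s • b + NormedSpace.exp (D • A) (d s)
        = (A (p s) + k (p s) • b) + (w s • b + NormedSpace.exp (D • A) (d s)) := by
      rw [hfb s hs, add_smul]
      abel
    have hVξ : -η * (‖p s‖ ^ 2 + u s ^ 2) ≤ -ξ * V s := by
      have := mul_le_mul_of_nonneg_left (hVle s hs) hξ0.le
      have e : ξ * (L * (‖p s‖ ^ 2 + u s ^ 2)) = η * (‖p s‖ ^ 2 + u s ^ 2) := by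
        rw [hξ]
        field_simp
      linarith
    refine le_trans ?_ hVξ
    refine le_trans ?_ key
    change ⟪A (p s) + U s • b + NormedSpace.exp (D • A) (d s), P (p s)⟫
      + ⟪p s, P (A (p s) + U s • b + NormedSpace.exp (D • A) (d s))⟫
      + a * (-weightedEnergy D U s + (U s ^ 2 - Real.exp (-D) * U (s - D) ^ 2)) ≤ _
    -- Symmetry of `P` merges the two product-rule terms into `2 ⟪P p, p'⟫`, which splits into
    -- nominal dissipation and perturbation.
    rw [← hPsymm, real_inner_comm, ← hPsymm, ← two_mul, hform, inner_add_right, mul_add]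
    linarith [hdiss (p s)]
  intro t ht
  obtain ⟨-, hxp, -⟩ := hbound A b x U t hA hb (memLp_window hU ht)
  obtain ⟨hpx, -, -⟩ := hbound A b x U 0 hA hb (memLp_window hU le_rfl)
  rw [← hp, ← hu] at hxp hpx
  have h₀ : ‖p 0‖ + u 0 ≤ (C₁ + 1) * (‖x 0‖ + u 0) := by
    linarith [norm_nonneg (x 0)]
  have h₁ : (‖p t‖ + u t) ^ 2
      ≤ 2 * L / m * (‖p 0‖ + u 0) ^ 2 * Real.exp (-(ξ / 2) * t) ^ 2 := by
    have e₁ : (‖p t‖ + u t) ^ 2 ≤ 2 * (‖p t‖ ^ 2 + u t ^ 2) := by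
      nlinarith [sq_nonneg (‖p t‖ - u t)]
    have e₂ : ‖p 0‖ ^ 2 + u 0 ^ 2 ≤ (‖p 0‖ + u 0) ^ 2 := by
      nlinarith [mul_nonneg (norm_nonneg (p 0)) (hu0 0)]
    have e₃ : Real.exp (-(ξ / 2) * t) ^ 2 = Real.exp (-ξ * t) := by
      rw [← Real.exp_nat_mul]
      congr 1
      push_cast
      ring
    have e₄ : m * (‖p t‖ ^ 2 + u t ^ 2)
        ≤ L * (‖p 0‖ + u 0) ^ 2 * Real.exp (-ξ * t) := by
      refine (hleV t ht).trans ((hdecay t ht).trans ?_)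
      gcongr
      exact (hVle 0 le_rfl).trans (by gcongr)
    rw [e₃]
    have e₅ : ‖p t‖ ^ 2 + u t ^ 2 ≤ L * (‖p 0‖ + u 0) ^ 2 * Real.exp (-ξ * t) / m := by
      rw [le_div_iff₀ hm0]
      linarith
    calc _ ≤ 2 * (L * (‖p 0‖ + u 0) ^ 2 * Real.exp (-ξ * t) / m) := by linarith
      _ = _ := by ring
  have h₂ : ‖p t‖ + u t ≤ √(2 * L / m) * (‖p 0‖ + u 0) * Real.exp (-(ξ / 2) * t) := by
    have hp0 := norm_nonneg (p 0)
    have hu00 := hu0 0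
    refine abs_le_of_sq_le_sq' ?_ (by positivity) |>.2
    rw [mul_pow, mul_pow, Real.sq_sqrt (by positivity)]
    exact h₁
  calc _ ≤ C₁ * (‖p t‖ + u t) := hxp
    _ ≤ C₁ * (√(2 * L / m) * ((C₁ + 1) * (‖x 0‖ + u 0)) * Real.exp (-(ξ / 2) * t)) := by
        gcongr
        exact h₂.trans (by gcongr)
    _ = _ := by rw [hρ]; ring

end Stability

/-! ### Measurability of the switching signal. -/

section Switching

variable {l : ℕ} {τ : ℝ} {σ : ℝ → Fin (l + 1)}

/-- The dwell time allows at most one switching time in each interval `[k τ, (k + 1) τ)`. -/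
theorem IsSwitchingSignal.countable_switchingTimes (hτ : 0 < τ) (hσ : IsSwitchingSignal τ σ) :
    {t | IsSwitchingTime σ t}.Countable := by
  refine Set.MapsTo.countable_of_injOn (f := fun t : ℝ => ⌊t / τ⌋) (Set.mapsTo_univ _ _) ?_
    Set.countable_univ
  have key : ∀ s t, IsSwitchingTime σ s → IsSwitchingTime σ t → ⌊s / τ⌋ = ⌊t / τ⌋ → ¬ s < t := by
    intro s t hs ht hst hlt
    have h₁ := hσ.dwell s t hs ht hlt
    have h₂ := Int.abs_sub_lt_one_of_floor_eq_floor hst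
    rw [← sub_div, abs_lt, lt_div_iff₀ hτ] at h₂
    linarith [h₂.1]
  intro s hs t ht hst
  exact le_antisymm (not_lt.1 (key t s ht hs hst.symm)) (not_lt.1 (key s t hs ht hst))

theorem IsSwitchingSignal.eventually_eq (hσ : IsSwitchingSignal τ σ) {t : ℝ} (ht : 0 < t)
    (hts : ¬ IsSwitchingTime σ t) : ∀ᶠ s in 𝓝 t, σ s = σ t := by
  rw [← nhdsLT_sup_nhdsGE, ← nhdsGT_sup_nhdsWithin_singleton, eventually_sup, eventually_sup]
  refine ⟨?_, hσ.right_continuous t ht.le, by simp⟩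
  by_contra h
  exact hts ⟨ht, h⟩

/-- Off a null set of switching times `σ` is locally constant, so the composition is continuous
there, for any `f`. -/
theorem IsSwitchingSignal.aestronglyMeasurable_comp (hτ : 0 < τ) (hσ : IsSwitchingSignal τ σ)
    {X : Type*} [TopologicalSpace X] [TopologicalSpace.PseudoMetrizableSpace X]
    (f : Fin (l + 1) → X) :
    AEStronglyMeasurable (fun t => f (σ t)) (volume.restrict (Set.Ici 0)) := by
  have hS := hσ.countable_switchingTimes hτ
  set S := {t | IsSwitchingTime σ t} with hSdef
  have hae : (Set.Ioi (0 : ℝ) \ S : Set ℝ) =ᵐ[volume] Set.Ici (0 : ℝ) :=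
    (sdiff_null_ae_eq_self (hS.measure_zero volume)).trans Ioi_ae_eq_Ici
  rw [← Measure.restrict_congr_set hae]
  refine ContinuousOn.aestronglyMeasurable (fun t ht => ?_)
    (measurableSet_Ioi.diff hS.measurableSet)
  have hev := hσ.eventually_eq ht.1 ht.2
  refine ContinuousAt.continuousWithinAt ?_
  refine (continuousAt_const (y := f (σ t))).congr ?_
  filter_upwards [hev] with s hs
  rw [hs]

end Switching

/-! ### The switched loop as a perturbation of mode 0. -/

section SwitchedLoop

variable {E : Type*} [NormedAddCommGroup E] [InnerProductSpace ℝ E]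

open scoped RealInnerProductSpace

theorem abs_average_sub_le {l : ℕ} (f : Fin (l + 1) → ℝ) (a B : ℝ) (h : ∀ i, |f i - a| ≤ B) :
    |∑ i, f i / ((l : ℝ) + 1) - a| ≤ B := by
  have hl : (0 : ℝ) < (l : ℝ) + 1 := by positivity
  have e : ∑ i, f i / ((l : ℝ) + 1) - a = (∑ i, (f i - a)) / ((l : ℝ) + 1) := by
    rw [← Finset.sum_div, Finset.sum_sub_distrib]
    simp only [Finset.sum_const, Finset.card_univ, Fintype.card_fin, nsmul_eq_mul]
    push_cast
    field_simp
  rw [e, abs_div, abs_of_pos hl, div_le_iff₀ hl]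
  refine (Finset.abs_sum_le_sum_abs _ _).trans ((Finset.sum_le_sum fun i _ => h i).trans_eq ?_)
  simp only [Finset.sum_const, Finset.card_univ, Fintype.card_fin, nsmul_eq_mul]
  push_cast
  ring

theorem intervalIntegrable_switched {l : ℕ} {D M : ℝ} (hD : 0 ≤ D) {A : Fin (l + 1) → E →L[ℝ] E}
    {b : Fin (l + 1) → E} {σ : ℝ → Fin (l + 1)} {x : ℝ → E} {U : ℝ → ℝ}
    (hA : ∀ i, ‖A i‖ ≤ M) (hb : ∀ i, ‖b i‖ ≤ M)
    (hσA : AEStronglyMeasurable (fun t => A (σ t)) (volume.restrict (Set.Ici 0)))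
    (hσb : AEStronglyMeasurable (fun t => b (σ t)) (volume.restrict (Set.Ici 0)))
    (hx : ContinuousOn x (Set.Ici 0))
    (hU : ∀ T, 0 ≤ T → MemLp U 2 (volume.restrict (Set.Icc (-D) T))) {t : ℝ} (ht : 0 ≤ t) :
    IntervalIntegrable (fun s => A (σ s) (x s) + U (s - D) • b (σ s)) volume 0 t := by
  have hsub : Set.Ioc 0 t ⊆ Set.Ici 0 := fun s hs => hs.1.le
  have hμ : volume.restrict (Set.Ioc 0 t) ≤ volume.restrict (Set.Ici 0) :=
    Measure.restrict_mono hsub le_rfl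
  have hxi : IntervalIntegrable x volume 0 t :=
    (hx.mono (by rw [Set.uIcc_of_le ht]; exact Set.Icc_subset_Ici_self)).intervalIntegrable
  have hUi : IntervalIntegrable (fun s => U (s - D)) volume 0 t := by
    have h := (intervalIntegrable_of_memLp (by linarith) (memLp_Ioc hU ht)).comp_sub_right D
    rw [neg_add_cancel] at h
    refine h.mono_set ?_
    rw [Set.uIcc_of_le ht, Set.uIcc_of_le (by linarith)]
    exact Set.Icc_subset_Icc_right (by linarith)
  rw [intervalIntegrable_iff_integrableOn_Ioc_of_le ht] at hxi hUi ⊢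
  refine Integrable.add ?_ ?_
  · exact (ContinuousLinearMap.id ℝ (E →L[ℝ] E)).integrable_of_bilin_of_bdd_left M
      (hσA.mono_measure hμ) (ae_of_all _ fun s => hA (σ s)) hxi
  · exact (ContinuousLinearMap.lsmul ℝ ℝ : ℝ →L[ℝ] E →L[ℝ] E).integrable_of_bilin_of_bdd_right M
      hUi (hσb.mono_measure hμ) (ae_of_all _ fun s => hb (σ s))

variable [CompleteSpace E]

/-- Exponential stability of the switched loop under the averaged predictor feedback, in operator
form, for a small mismatch `ε` between the modes. -/
theorem exists_decay_of_switching {D M q c : ℝ} (hD : 0 < D) (hM : 1 ≤ M)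
    (hq : 0 < q) (hc : 0 < c) (P : E →L[ℝ] E) (hPsymm : ∀ x y, ⟪P x, y⟫ = ⟪x, P y⟫)
    (hPpos : ∀ x, c * ‖x‖ ^ 2 ≤ ⟪x, P x⟫) :
    ∃ δ ρ ξ : ℝ, 0 < δ ∧ 0 < ρ ∧ 0 < ξ ∧ ∀ (l : ℕ) (A : Fin (l + 1) → E →L[ℝ] E)
      (b : Fin (l + 1) → E) (k : Fin (l + 1) → E →L[ℝ] ℝ) (ε : ℝ) (σ : ℝ → Fin (l + 1))
      (x : ℝ → E) (U : ℝ → ℝ), (∀ i, ‖A i‖ ≤ M) → (∀ i, ‖b i‖ ≤ M) → (∀ i, ‖k i‖ ≤ M) →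
      (∀ i, ‖A i - A 0‖ ≤ ε) → (∀ i, ‖b i - b 0‖ ≤ ε) → (∀ i, ‖k i - k 0‖ ≤ ε) → ε ≤ δ →
      (∀ y, 2 * ⟪P y, A 0 y + k 0 y • b 0⟫ ≤ -q * ‖y‖ ^ 2) →
      AEStronglyMeasurable (fun t => A (σ t)) (volume.restrict (Set.Ici 0)) →
      AEStronglyMeasurable (fun t => b (σ t)) (volume.restrict (Set.Ici 0)) →
      ContinuousOn x (Set.Ici 0) →
      (∀ T, 0 ≤ T → MemLp U 2 (volume.restrict (Set.Icc (-D) T))) →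
      (∀ t, 0 ≤ t → x t = x 0 + ∫ s in (0 : ℝ)..t, (A (σ s) (x s) + U (s - D) • b (σ s))) →
      (∀ t, 0 ≤ t → U t = ∑ i, k i (opPredictor D (A i) (b i) x U t) / ((l : ℝ) + 1)) →
      ∀ t, 0 ≤ t → ‖x t‖ + inputNorm D U t
        ≤ ρ * (‖x 0‖ + inputNorm D U 0) * Real.exp (-ξ * t) := by
  obtain ⟨C₁, hC₁, hbound⟩ := exists_opPredictor_bounds E hD hM
  -- In the bound on `w`, `C₁` accounts for the mismatch of the gains and `C₁ * M` for that of the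
  -- predictors.
  have hC : 1 ≤ C₁ * (1 + M) := by nlinarith
  obtain ⟨δ, ρ, ξ, hδ, hρ, hξ, hdecay⟩ :=
    exists_decay_of_perturbation hD hM hC hq hc P hPsymm hPpos
  refine ⟨δ, ρ, ξ, hδ, hρ, hξ, ?_⟩
  intro l A b k ε σ x U hA hb hk hAε hbε hkε hεδ hdiss hσA hσb hx hU hdyn hfb
  have hε : 0 ≤ ε := (norm_nonneg _).trans (hAε 0)
  refine hdecay (A 0) (b 0) (k 0) ε x
    (fun t => (A (σ t) - A 0) (x t) + U (t - D) • (b (σ t) - b 0)) U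
    (fun t => U t - k 0 (opPredictor D (A 0) (b 0) x U t)) (hA 0) (hb 0) (hk 0) hε hεδ hdiss hU
    ?_ (fun t _ => by ring) (fun t _ => ?_) fun t ht => ?_
  · have h : HasIntegralDeriv x (fun s => A (σ s) (x s) + U (s - D) • b (σ s)) :=
      ⟨fun t ht => intervalIntegrable_switched hD.le hA hb hσA hσb hx hU ht, hdyn⟩
    refine h.congr (fun _ _ => rfl) fun t _ => ?_
    rw [sub_apply, smul_sub]
    abel
  · have hu := inputNorm_nonneg D U t
    calc _ ≤ ε * ‖x t‖ + |U (t - D)| * ε := by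
          refine (norm_add_le _ _).trans (add_le_add ?_ ?_)
          · exact (ContinuousLinearMap.le_opNorm _ _).trans (by gcongr; exact hAε _)
          · rw [norm_smul, Real.norm_eq_abs]
            gcongr
            exact hbε _
      _ ≤ 1 * ε * (‖x t‖ + inputNorm D U t + |U (t - D)|) := by
          have : 0 ≤ ε * inputNorm D U t := by positivity
          linarith
      _ ≤ _ := by gcongr
  · have hu := inputNorm_nonneg D U t
    simp only [hfb t ht]
    refine abs_average_sub_le _ _ _ fun i => ?_
    obtain ⟨hpi, -, hdiff⟩ := hbound (A i) (b i) x U t (hA i) (hb i) (memLp_window hU ht)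
    have hdiff := hdiff (A 0) (b 0) ε (hA 0) (hb 0) (hAε i) (hbε i)
    have e : k i (opPredictor D (A i) (b i) x U t) - k 0 (opPredictor D (A 0) (b 0) x U t)
        = (k i - k 0) (opPredictor D (A i) (b i) x U t)
          + k 0 (opPredictor D (A i) (b i) x U t - opPredictor D (A 0) (b 0) x U t) := by
      rw [sub_apply, map_sub]
      ring
    rw [e]
    calc _ ≤ ε * (C₁ * (‖x t‖ + inputNorm D U t))
          + M * (C₁ * ε * (‖x t‖ + inputNorm D U t)) := by
          refine (abs_add_le _ _).trans (add_le_add ?_ ?_)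
          · refine ((k i - k 0).le_opNorm _).trans ?_
            gcongr
            exact hkε i
          · refine ((k 0).le_opNorm _).trans ?_
            gcongr
            exact hk 0
      _ = _ := by ring

end SwitchedLoop

/-! ### From matrices to operators on Euclidean space. -/

section Translation

open Matrix

variable {n : ℕ}

/-- The single column of an input matrix as a Euclidean vector. -/
noncomputable def inputVector (B : Matrix (Fin n) (Fin 1) ℝ) : EuclideanSpace ℝ (Fin n) :=
  WithLp.toLp 2 (B *ᵥ ![1])

/-- The single row of a gain matrix as a functional on Euclidean space. -/
noncomputable def gainFunctional (K : Matrix (Fin 1) (Fin n) ℝ) :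
    EuclideanSpace ℝ (Fin n) →L[ℝ] ℝ :=
  (EuclideanSpace.proj (0 : Fin 1)).comp (LinearMap.toContinuousLinearMap (toEuclideanLin K))

theorem gainFunctional_apply (K : Matrix (Fin 1) (Fin n) ℝ) (y : EuclideanSpace ℝ (Fin n)) :
    gainFunctional K y = (K *ᵥ y.ofLp) 0 := rfl

theorem toLp_mulVec_single (B : Matrix (Fin n) (Fin 1) ℝ) (r : ℝ) :
    WithLp.toLp 2 (B *ᵥ ![r]) = r • inputVector B := by
  rw [inputVector, ← WithLp.toLp_smul, ← Matrix.mulVec_smul]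
  simp

theorem inputVector_sub (B B' : Matrix (Fin n) (Fin 1) ℝ) :
    inputVector B - inputVector B' = inputVector (B - B') := by
  rw [inputVector, inputVector, inputVector, ← WithLp.toLp_sub, Matrix.sub_mulVec]

theorem norm_inputVector_le (B : Matrix (Fin n) (Fin 1) ℝ) : ‖inputVector B‖ ≤ ‖B‖ := by
  have h := Matrix.l2_opNorm_mulVec B (WithLp.toLp 2 ![(1 : ℝ)])
  have e : ‖(WithLp.toLp 2 ![(1 : ℝ)] : EuclideanSpace ℝ (Fin 1))‖ = 1 := by
    simp [EuclideanSpace.norm_eq]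
  rw [e, mul_one] at h
  exact h

theorem gainFunctional_sub (K K' : Matrix (Fin 1) (Fin n) ℝ) :
    gainFunctional K - gainFunctional K' = gainFunctional (K - K') := by
  ext y
  simp [gainFunctional_apply, Matrix.sub_mulVec]

theorem norm_gainFunctional_le (K : Matrix (Fin 1) (Fin n) ℝ) : ‖gainFunctional K‖ ≤ ‖K‖ :=
  ContinuousLinearMap.opNorm_le_bound _ (norm_nonneg _) fun y =>
    (PiLp.norm_apply_le (WithLp.toLp 2 (K *ᵥ y.ofLp)) 0).trans (Matrix.l2_opNorm_mulVec K y)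

/-- An algebra homomorphism commutes with the exponential once continuous; for the `L²` operator
norm this one is an isometry. -/
theorem toEuclideanCLM_exp (A : Matrix (Fin n) (Fin n) ℝ) (s : ℝ) :
    toEuclideanCLM (𝕜 := ℝ) (NormedSpace.exp (s • A))
      = NormedSpace.exp (s • toEuclideanCLM (𝕜 := ℝ) A) := by
  let _ : NormedAlgebra ℚ (Matrix (Fin n) (Fin n) ℝ) := .restrictScalars ℚ ℝ _
  rw [NormedSpace.map_exp (toEuclideanCLM (n := Fin n) (𝕜 := ℝ)) ?_, map_smul]
  exact (AddMonoidHomClass.isometry_of_norm _ fun A => l2_opNorm_toEuclideanCLM A).continuous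

theorem toLp_intervalIntegral (f : ℝ → Fin n → ℝ) (a b : ℝ) :
    WithLp.toLp 2 (∫ s in a..b, f s) = ∫ s in a..b, WithLp.toLp 2 (f s) := by
  have h := fun μ : Measure ℝ =>
    (PiLp.continuousLinearEquiv 2 ℝ (fun _ : Fin n => ℝ)).symm.integral_comp_comm (μ := μ) f
  rw [intervalIntegral, intervalIntegral, WithLp.toLp_sub]
  exact congrArg₂ (· - ·) (h _).symm (h _).symm

theorem toLp_predictor (D : ℝ) (A : Matrix (Fin n) (Fin n) ℝ) (B : Matrix (Fin n) (Fin 1) ℝ)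
    (X : ℝ → Fin n → ℝ) (U : ℝ → ℝ) (t : ℝ) :
    WithLp.toLp 2 (predictor D A B X U t)
      = opPredictor D (toEuclideanCLM (𝕜 := ℝ) A) (inputVector B) (fun s => WithLp.toLp 2 (X s)) U
        t := by
  rw [predictor, opPredictor, WithLp.toLp_add, toLp_intervalIntegral, ← toEuclideanCLM_toLp,
    toEuclideanCLM_exp]
  congr 1
  refine intervalIntegral.integral_congr fun θ _ => ?_
  rw [← toEuclideanCLM_toLp, toLp_mulVec_single, map_smul, toEuclideanCLM_exp]

open scoped RealInnerProductSpace

/-- The quadratic form has a positive lower bound on the compact unit sphere, and both sides are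
homogeneous of degree two. -/
theorem exists_mul_sq_le_inner {P : Matrix (Fin n) (Fin n) ℝ} (hP : P.PosDef) :
    ∃ c : ℝ, 0 < c ∧ ∀ x : EuclideanSpace ℝ (Fin n),
      c * ‖x‖ ^ 2 ≤ ⟪x, toEuclideanCLM (𝕜 := ℝ) P x⟫ := by
  have hcont : Continuous fun x : EuclideanSpace ℝ (Fin n) => ⟪x, toEuclideanCLM (𝕜 := ℝ) P x⟫ :=
    continuous_id.inner (toEuclideanCLM (𝕜 := ℝ) P).continuous
  obtain ⟨c, hc, h⟩ := (isCompact_sphere (0 : EuclideanSpace ℝ (Fin n)) 1).exists_forall_le'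
    hcont.continuousOn (a := 0) fun x hx => by
      have hx0 : x ≠ 0 := ne_zero_of_mem_unit_sphere ⟨x, hx⟩
      rw [inner_toEuclideanCLM]
      simpa using hP.dotProduct_mulVec_pos (x := x.ofLp) (by simpa using hx0)
  refine ⟨c, hc, fun x => ?_⟩
  rcases eq_or_ne x 0 with rfl | hx
  · simp
  have hx0 : 0 < ‖x‖ := norm_pos_iff.2 hx
  have h₁ := h (‖x‖⁻¹ • x) (by simp [norm_smul, hx0.ne'])
  rw [map_smul, inner_smul_left, inner_smul_right, RCLike.conj_to_real, ← mul_assoc] at h₁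
  calc c * ‖x‖ ^ 2 ≤ ‖x‖⁻¹ * ‖x‖⁻¹ * ⟪x, toEuclideanCLM (𝕜 := ℝ) P x⟫ * ‖x‖ ^ 2 := by gcongr
    _ = _ := by field_simp

theorem inner_toEuclideanCLM_symm {P : Matrix (Fin n) (Fin n) ℝ} (hP : P.IsHermitian)
    (x y : EuclideanSpace ℝ (Fin n)) :
    ⟪toEuclideanCLM (𝕜 := ℝ) P x, y⟫ = ⟪x, toEuclideanCLM (𝕜 := ℝ) P y⟫ := by
  have hPT : Pᵀ = P := by simpa using hP.eq
  rw [real_inner_comm, inner_toEuclideanCLM, inner_toEuclideanCLM, dotProduct_mulVec,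
    ← mulVec_transpose, hPT, dotProduct_comm]

/-- The Lyapunov matrix inequality as an inequality for the quadratic form of `P`. -/
theorem two_mul_inner_le_of_posSemidef {P Q A : Matrix (Fin n) (Fin n) ℝ}
    {B : Matrix (Fin n) (Fin 1) ℝ} {K : Matrix (Fin 1) (Fin n) ℝ} (hP : P.IsHermitian)
    (h : (-Q - ((A + B * K)ᵀ * P + P * (A + B * K))).PosSemidef)
    (y : EuclideanSpace ℝ (Fin n)) :
    2 * ⟪toEuclideanCLM (𝕜 := ℝ) P y,
        toEuclideanCLM (𝕜 := ℝ) A y + gainFunctional K y • inputVector B⟫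
      ≤ -⟪y, toEuclideanCLM (𝕜 := ℝ) Q y⟫ := by
  have hcl : toEuclideanCLM (𝕜 := ℝ) A y + gainFunctional K y • inputVector B
      = toEuclideanCLM (𝕜 := ℝ) (A + B * K) y := by
    have e : ![gainFunctional K y] = K *ᵥ y.ofLp := by
      ext i
      fin_cases i
      rfl
    rw [← toLp_mulVec_single, e, mulVec_mulVec, map_add, _root_.add_apply]
    rfl
  rw [hcl]
  set R := A + B * K
  have hPT : Pᵀ = P := by simpa using hP.eq
  have h₁ := h.dotProduct_mulVec_nonneg y.ofLp
  rw [star_trivial, sub_mulVec, neg_mulVec, add_mulVec, dotProduct_sub, dotProduct_neg,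
    dotProduct_add] at h₁
  have h₂ : y.ofLp ⬝ᵥ (Rᵀ * P) *ᵥ y.ofLp = y.ofLp ⬝ᵥ (P * R) *ᵥ y.ofLp := by
    rw [dotProduct_mulVec, ← mulVec_transpose, dotProduct_comm, transpose_mul, transpose_transpose,
      hPT]
  rw [inner_toEuclideanCLM_symm hP, ← mul_apply_eq_comp, ← map_mul, inner_toEuclideanCLM,
    inner_toEuclideanCLM]
  linarith

theorem le_mismatch {l : ℕ} (A : Fin (l + 1) → Matrix (Fin n) (Fin n) ℝ)
    (B : Fin (l + 1) → Matrix (Fin n) (Fin 1) ℝ) (K : Fin (l + 1) → Matrix (Fin 1) (Fin n) ℝ)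
    (i j : Fin (l + 1)) : ‖A i - A j‖ ≤ mismatch A B K ∧ ‖B i - B j‖ ≤ mismatch A B K ∧
      ‖K i - K j‖ ≤ mismatch A B K := by
  have h := le_ciSup (f := fun p : Fin (l + 1) × Fin (l + 1) =>
    max ‖A p.1 - A p.2‖ (max ‖B p.1 - B p.2‖ ‖K p.1 - K p.2‖)) (Set.finite_range _).bddAbove (i, j)
  exact ⟨(le_max_left _ _).trans h, ((le_max_left _ _).trans (le_max_right _ _)).trans h,
    ((le_max_right _ _).trans (le_max_right _ _)).trans h⟩

end Translation

end SwitchedDelay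

theorem theorem2p1 (n : ℕ) (D τ : ℝ) (hD : 0 < D) (hτ : 0 < τ)
    (P Q : Matrix (Fin n) (Fin n) ℝ) (hP : P.PosDef) (hQ : Q.PosDef) (MA MB MK : ℝ) :
    ∃ εstar : ℝ, 0 < εstar ∧
      ∀ (l : ℕ) (A : Fin (l + 1) → Matrix (Fin n) (Fin n) ℝ)
        (B : Fin (l + 1) → Matrix (Fin n) (Fin 1) ℝ)
        (K : Fin (l + 1) → Matrix (Fin 1) (Fin n) ℝ),
        (∀ i, ‖A i‖ ≤ MA) → (∀ i, ‖B i‖ ≤ MB) → (∀ i, ‖K i‖ ≤ MK) →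
        (∀ i, (-Q - ((A i + B i * K i)ᵀ * P + P * (A i + B i * K i))).PosSemidef) →
        SwitchedDelay.mismatch A B K < εstar →
        ∃ ρ ξ : ℝ, 0 < ρ ∧ 0 < ξ ∧
          ∀ σ : ℝ → Fin (l + 1), SwitchedDelay.IsSwitchingSignal τ σ →
          ∀ (X₀ : Fin n → ℝ) (U₀ : ℝ → ℝ), MemLp U₀ 2 (volume.restrict (Set.Ico (-D) 0)) →
          ∀ (X : ℝ → Fin n → ℝ) (U : ℝ → ℝ),
            SwitchedDelay.IsClosedLoopSolution D A B K σ X₀ U₀ X U →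
            ∀ t : ℝ, 0 ≤ t →
              SwitchedDelay.stateNorm D X U t
                ≤ ρ * (‖WithLp.toLp 2 X₀‖ + √(∫ θ in (-D)..0, U₀ θ ^ 2)) * Real.exp (-ξ * t) := by
  obtain ⟨c, hc, hPpos⟩ := SwitchedDelay.exists_mul_sq_le_inner hP
  obtain ⟨q, hq, hQpos⟩ := SwitchedDelay.exists_mul_sq_le_inner hQ
  -- A single bound for all three families; the summand `1` gives the `1 ≤ M` required by the
  -- estimates.
  set M := 1 + |MA| + |MB| + |MK| with hM
  have hMA : MA ≤ M := by linarith [le_abs_self MA, abs_nonneg MB, abs_nonneg MK]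
  have hMB : MB ≤ M := by linarith [le_abs_self MB, abs_nonneg MA, abs_nonneg MK]
  have hMK : MK ≤ M := by linarith [le_abs_self MK, abs_nonneg MB, abs_nonneg MA]
  have hM1 : 1 ≤ M := by linarith [abs_nonneg MA, abs_nonneg MB, abs_nonneg MK]
  obtain ⟨δ, ρ, ξ, hδ, hρ, hξ, hdecay⟩ := SwitchedDelay.exists_decay_of_switching hD hM1 hq hc
    (Matrix.toEuclideanCLM (𝕜 := ℝ) P) (SwitchedDelay.inner_toEuclideanCLM_symm hP.1) hPpos
  refine ⟨δ, hδ, fun l A B K hA hB hK hlyap hmis => ⟨ρ, ξ, hρ, hξ, ?_⟩⟩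
  intro σ hσ X₀ U₀ _ X U hsol t ht
  have hε := fun i => SwitchedDelay.le_mismatch A B K i 0
  have key := hdecay l (fun i => Matrix.toEuclideanCLM (𝕜 := ℝ) (A i))
    (fun i => SwitchedDelay.inputVector (B i)) (fun i => SwitchedDelay.gainFunctional (K i))
    (SwitchedDelay.mismatch A B K) σ (fun s => WithLp.toLp 2 (X s)) U
    (fun i => (hA i).trans hMA)
    (fun i => (SwitchedDelay.norm_inputVector_le _).trans ((hB i).trans hMB))
    (fun i => (SwitchedDelay.norm_gainFunctional_le _).trans ((hK i).trans hMK))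
    (fun i => by
      rw [← map_sub]
      exact (hε i).1)
    (fun i => by
      rw [SwitchedDelay.inputVector_sub]
      exact (SwitchedDelay.norm_inputVector_le _).trans (hε i).2.1)
    (fun i => by
      rw [SwitchedDelay.gainFunctional_sub]
      exact (SwitchedDelay.norm_gainFunctional_le _).trans (hε i).2.2)
    hmis.le
    (fun y => (SwitchedDelay.two_mul_inner_le_of_posSemidef hP.1 (hlyap 0) y).trans
      (by linarith [hQpos y]))
    (hσ.aestronglyMeasurable_comp hτ fun i => Matrix.toEuclideanCLM (𝕜 := ℝ) (A i))
    (hσ.aestronglyMeasurable_comp hτ fun i => SwitchedDelay.inputVector (B i))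
    ((PiLp.continuous_toLp 2 _).comp_continuousOn hsol.state_continuous) hsol.input_memLp
    (fun s hs => by
      conv_lhs => rw [hsol.dynamics s hs, WithLp.toLp_add, SwitchedDelay.toLp_intervalIntegral]
      simp only [WithLp.toLp_add, SwitchedDelay.toLp_mulVec_single, Matrix.toEuclideanCLM_toLp])
    (fun s hs => by
      rw [hsol.feedback s hs, SwitchedDelay.averagedFeedback]
      simp only [← SwitchedDelay.toLp_predictor, SwitchedDelay.gainFunctional_apply])
    t ht
  -- `U` agrees with `U₀` only almost everywhere on `[-D, 0)`, while `U 0` is fixed by the feedback;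
  -- exchanging endpoints does not change the integral.
  have h₀ : SwitchedDelay.inputNorm D U 0 = √(∫ θ in (-D)..0, U₀ θ ^ 2) := by
    rw [SwitchedDelay.inputNorm, zero_sub, intervalIntegral.integral_of_le (by linarith),
      intervalIntegral.integral_of_le (by linarith), ← integral_Ico_eq_integral_Ioc,
      ← integral_Ico_eq_integral_Ioc]
    congr 1
    refine integral_congr_ae ?_
    filter_upwards [hsol.initial_input] with θ hθ
    rw [hθ]
  rw [h₀, hsol.initial_state] at key
  exact key
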